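/- **Conventions.** Let $(M,g)$ be a semi-Riemannian manifold (smooth, Hausdorff, second countable) with Levi-Civita connection $\nabla$. The curvature is $R_{ijkl}=g(R(\partial_i,\partial_j)\partial_k,\partial_l)$ with $R(X,Y)=\nabla_{[X,Y]}-[\nabla_X,\nabla_Y]$, the Ricci tensor is $S_{jk}=g^{il}R_{ijkl}$, the scalar curvature is $\kappa=g^{jk}S_{jk}$, and for symmetric $(0,2)$-tensors $(A\wedge E)_{ijkl}=A_{il}E_{jk}+A_{jk}E_{il}-A_{ik}E_{jl}-A_{jl}E_{ik}$. Let $U_g\subseteq M$ be the set of points at which $\nabla R\neq\xi\otimes R$ for every covector $\xi$. For smooth 1-forms $\Pi,\Phi,\Psi,\Theta$, $M$ is called $SGK$ with $(\Pi,\Phi,\Psi,\Theta)$ if $$\nabla R=\Pi\otimes R+\Phi\otimes S\wedge S+\Psi\otimes g\wedge S+\Theta\otimes g\wedge g$$ at every point of $U_g$, and $WGK$ with $(\Pi,\Phi)$ if $$\nabla R=\Pi\otimes R+\Phi\otimes S\wedge S\qquad(*)$$ at every point of $U_g$. Let $(\overline M,\overline g)$ and $(\widetilde M,\widetilde g)$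 be semi-Riemannian manifolds, $\widetilde M\neq\emptyset$, $q=\dim\widetilde M$, let $f>0$ be a smooth function on $\overline M$, and let $M=\overline M\times_f\widetilde M$ be the warped product, with $g=\overline g+f\widetilde g$. Bars and tildes denote the objects of the base and of the fiber; for a 1-form $\alpha$ on $M$, $\overline\alpha$ and $\widetilde\alpha$ denote its restrictions to the directions of $\overline M$ and of $\widetilde M$. On $\overline M$ put $$T_{ab}=-\tfrac1{2f}\Big(\overline\nabla_b f_a-\tfrac1{2f}f_af_b\Big),\quad P=\tfrac1{4f^2}\overline g^{ab}f_af_b,\quad Q=f\big((q-1)P-\mathrm{tr}\,T\big),\quad \mathrm{tr}\,T=\overline g^{ab}T_{ab}.$$ **Statement.** Suppose that $M$ is $WGK$ with $(\Pi,\Phi)$, and let $D\supseteq U_g$ be the set of all points of $M$ at which $(*)$ holds. Then: (i) If $T=\lambda\overline S$ for some $\lambda\in C^\infty(\overline M)$, then $\overline M$ is $WGK$ with some pair of 1-forms, which can be chosen so that its relation $(*)$ also holds at every $x\in\overline M$ with $\{x\}\times\widetilde M\subseteq D$. (ii) For every $x\in\overline M$, $\widetilde M$ is $SGK$ with $$\Big(\widetilde\Pi,\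 \tfrac1f\widetilde\Phi,\ \tfrac{2Q}{f}\widetilde\Phi,\ \tfrac12 fP\,\widetilde\Pi+\tfrac{Q^2}{f}\widetilde\Phi\Big),$$ where $f,P,Q$ are evaluated at $x$ and the forms are restricted to the slice $\{x\}\times\widetilde M$; moreover the $SGK$ relation with these forms holds at every $y\in\widetilde M$ with $(x,y)\in D$. (iii) $\widetilde M$ is of Roter type with $(\widetilde R;\widetilde g,\widetilde S)$ where $df+f\overline\Pi\neq0$: there are functions $N_1,N_2,N_3$ on $M$, smooth on the open set $W=\{z\in M:(df+f\overline\Pi)_z\neq0\}$, such that for each $z=(x,y)\in W\cap D$, at $y$, $$\widetilde R=N_1(z)\,\widetilde g\wedge\widetilde g-N_2(z)\,\widetilde g\wedge\widetilde S-N_3(z)\,\widetilde S\wedge\widetilde S .$$ (iv) $\widetilde M$ satisfies the Einstein condition $\widetilde S=\frac{\widetilde\kappa}{q}\widetilde g$ at $y$ for every $z=(x,y)\in D$ with $\big((\overline\kappa-q\,\mathrm{tr}\,T)\Phi\big)_z\neq0$. If $df_x\neq0$ for some $x\in\overline M$, then $\widetilde M$ is of constant curvature: there is $c\in\mathbb R$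 with $\widetilde R=c\,\widetilde g\wedge\widetilde g$ on all of $\widetilde M$. -/

import Mathlib

set_option maxSynthPendingDepth 3

open scoped Manifold ContDiff

/-! ### Tensor calculus of a metric on an open subset of a vector space -/

namespace WarpedRecurrent

noncomputable section

section Model

variable {E : Type*} [NormedAddCommGroup E] [NormedSpace ℝ E]

/-- Cyclic permutation of the arguments of a trilinear map: `rot B u v w = B w u v`. -/
def rot {V : Type*} [NormedAddCommGroup V] [NormedSpace ℝ V]
    (B : E →L[ℝ] E →L[ℝ] E →L[ℝ] V) : E →L[ℝ] E →L[ℝ] E →L[ℝ] V :=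
  ((ContinuousLinearMap.flipₗᵢ ℝ E E V).toContinuousLinearEquiv :
    (E →L[ℝ] E →L[ℝ] V) →L[ℝ] (E →L[ℝ] E →L[ℝ] V)).comp B.flip

theorem rot_apply {V : Type*} [NormedAddCommGroup V] [NormedSpace ℝ V]
    (B : E →L[ℝ] E →L[ℝ] E →L[ℝ] V) (u v w : E) : rot B u v w = B w u v := rfl

/-- Christoffel symbols of the first kind:
`Γ(u,v;w) = ½ (∂_u G(v,w) + ∂_v G(u,w) - ∂_w G(u,v))`. -/
def christoffelFirst (G : E → E →L[ℝ] E →L[ℝ] ℝ) (x : E) : E →L[ℝ] E →L[ℝ] E →L[ℝ] ℝ :=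
  (1 / 2 : ℝ) • (fderiv ℝ G x + (fderiv ℝ G x).flip - rot (fderiv ℝ G x))

theorem christoffelFirst_apply (G : E → E →L[ℝ] E →L[ℝ] ℝ) (x u v w : E) :
    christoffelFirst G x u v w =
      1 / 2 * (fderiv ℝ G x u v w + fderiv ℝ G x v u w - fderiv ℝ G x w u v) := rfl

/-- Christoffel symbols `Γ(u,v)` of the Levi-Civita connection; the inverse of the metric
(`(G x).inverse`, from covectors to vectors) raises the last index. -/
def christoffel (G : E → E →L[ℝ] E →L[ℝ] ℝ) (x : E) : E →L[ℝ] E →L[ℝ] E :=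
  (ContinuousLinearMap.compL ℝ E (E →L[ℝ] ℝ) E (G x).inverse).comp (christoffelFirst G x)

theorem christoffel_apply (G : E → E →L[ℝ] E →L[ℝ] ℝ) (x u v : E) :
    christoffel G x u v = (G x).inverse (christoffelFirst G x u v) := rfl

/-- The curvature operator `R(u,v) = ∇_{[u,v]} - [∇_u, ∇_v]` on constant vector fields. -/
def curvOp (G : E → E →L[ℝ] E →L[ℝ] ℝ) (x : E) : E →L[ℝ] E →L[ℝ] E →L[ℝ] E :=
  let A : E →L[ℝ] E →L[ℝ] E →L[ℝ] E := fderiv ℝ (christoffel G) x +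
    (ContinuousLinearMap.compL ℝ E E E).bilinearComp (christoffel G x) (christoffel G x)
  A.flip - A

theorem curvOp_apply (G : E → E →L[ℝ] E →L[ℝ] ℝ) (x u v w : E) :
    curvOp G x u v w =
      (fderiv ℝ (christoffel G) x v u w + christoffel G x v (christoffel G x u w)) -
      (fderiv ℝ (christoffel G) x u v w + christoffel G x u (christoffel G x v w)) := rfl

/-- The curvature tensor `R_{ijkl} = g(R(∂_i,∂_j)∂_k, ∂_l)`. -/
def riem (G : E → E →L[ℝ] E →L[ℝ] ℝ) (x u v w t : E) : ℝ := G x (curvOp G x u v w) t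

/-- The covariant derivative `R_{ijkl,m}` of the curvature tensor; `m` is the direction of
differentiation. -/
def covRiem (G : E → E →L[ℝ] E →L[ℝ] ℝ) (x m u v w t : E) : ℝ :=
  fderiv ℝ (fun y => riem G y u v w t) x m
    - riem G x (christoffel G x m u) v w t - riem G x u (christoffel G x m v) w t
    - riem G x u v (christoffel G x m w) t - riem G x u v w (christoffel G x m t)

/-- The trace as a continuous linear functional (`E` is finite dimensional). -/
def traceCLM [FiniteDimensional ℝ E] : (E →L[ℝ] E) →L[ℝ] ℝ :=
  LinearMap.toContinuousLinearMap
    ((LinearMap.trace ℝ E).comp (ContinuousLinearMap.coeLM ℝ : (E →L[ℝ] E) →ₗ[ℝ] (E →ₗ[ℝ] E)))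

/-- The trace `g^{ij} h_{ij}` of a bilinear form `h` with respect to the metric `b`. -/
def metricTrace [FiniteDimensional ℝ E] (b h : E →L[ℝ] E →L[ℝ] ℝ) : ℝ :=
  traceCLM (b.inverse.comp h)

/-- The Ricci tensor `S_{jk} = g^{il} R_{ijkl}`, i.e. `S(v,w) = tr (u ↦ R(u,v)w)`. -/
def ric [FiniteDimensional ℝ E] (G : E → E →L[ℝ] E →L[ℝ] ℝ) (x : E) : E →L[ℝ] E →L[ℝ] ℝ :=
  (ContinuousLinearMap.compL ℝ E (E →L[ℝ] E) ℝ traceCLM).comp (rot (curvOp G x))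

theorem ric_apply [FiniteDimensional ℝ E] (G : E → E →L[ℝ] E →L[ℝ] ℝ) (x v w : E) :
    ric G x v w = LinearMap.trace ℝ E (((curvOp G x).flip v).flip w : E →L[ℝ] E) := rfl

/-- The Hessian `∇_b f_a = ∂_b ∂_a f - Γ^c_{ab} f_c`. -/
def hess (G : E → E →L[ℝ] E →L[ℝ] ℝ) (F : E → ℝ) (x : E) : E →L[ℝ] E →L[ℝ] ℝ :=
  fderiv ℝ (fderiv ℝ F) x -
    (ContinuousLinearMap.compL ℝ E E ℝ (fderiv ℝ F x)).comp (christoffel G x)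

/-- The Kulkarni-Nomizu product
`(A ∧ B)_{ijkl} = A_{il} B_{jk} + A_{jk} B_{il} - A_{ik} B_{jl} - A_{jl} B_{ik}`. -/
def kn (A B : E →L[ℝ] E →L[ℝ] ℝ) (u v w t : E) : ℝ :=
  A u t * B v w + A v w * B u t - A u w * B v t - A v t * B u w

end Model

/-! ### Semi-Riemannian manifolds

All tensors at a point `z` of a manifold are computed in the preferred chart at `z`, which
identifies the tangent space at `z` with the model vector space `E` (this is Mathlib's
identification `TangentSpace I z = E`). -/

section Manifold

variable {E : Type*} [NormedAddCommGroup E] [NormedSpace ℝ E]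
  {H : Type*} [TopologicalSpace H] (I : ModelWithCorners ℝ E H)
  {M : Type*} [TopologicalSpace M] [ChartedSpace H M]

/-- Fields of bilinear forms on the tangent spaces. -/
abbrev BilinField (M : Type*) [TopologicalSpace M] [ChartedSpace H M] : Type _ :=
  ∀ z : M, TangentSpace I z →L[ℝ] TangentSpace I z →L[ℝ] ℝ

/-- Fields of covectors on the tangent spaces (1-forms, without a smoothness condition). -/
abbrev CovectorField (M : Type*) [TopologicalSpace M] [ChartedSpace H M] : Type _ :=
  ∀ z : M, TangentSpace I z →L[ℝ] ℝ

/-- The derivative at `u` of the inverse of the chart at `z`. -/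
def chartInvDeriv (z : M) (u : E) : E →L[ℝ] E :=
  mfderiv 𝓘(ℝ, E) I (extChartAt I z).symm u

variable {I}

/-- The components of a field of bilinear forms in the chart at `z`. -/
def chartBilin (g : BilinField I M) (z : M) (u : E) : E →L[ℝ] E →L[ℝ] ℝ :=
  ContinuousLinearMap.bilinearComp (E := E) (F := E) (G := ℝ) (g ((extChartAt I z).symm u))
    (chartInvDeriv I z u) (chartInvDeriv I z u)

/-- The components of a field of covectors in the chart at `z`. -/
def chartCovector (α : CovectorField I M) (z : M) (u : E) : E →L[ℝ] ℝ :=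
  ContinuousLinearMap.comp (M₂ := E) (α ((extChartAt I z).symm u)) (chartInvDeriv I z u)

/-- `α` is a smooth 1-form: its components are smooth in the charts. -/
def IsSmoothForm (α : CovectorField I M) : Prop :=
  ∀ z : M, ContDiffOn ℝ ∞ (chartCovector α z) (extChartAt I z).target

/-- `g` is a semi-Riemannian metric: symmetric, nondegenerate, with smooth components in the
charts. -/
structure IsSemiRiemannian (g : BilinField I M) : Prop where
  symm : ∀ (z : M) (u v : TangentSpace I z), g z u v = g z v u
  nondegenerate : ∀ (z : M) (u : TangentSpace I z), (∀ v, g z u v = 0) → u = 0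
  smooth : ∀ z : M, ContDiffOn ℝ ∞ (chartBilin g z) (extChartAt I z).target

/-- The Riemann-Christoffel curvature tensor `R_{ijkl}` at `z`. -/
def curvature (g : BilinField I M) (z : M) (u v w t : TangentSpace I z) : ℝ :=
  riem (chartBilin g z) (extChartAt I z z) u v w t

/-- The components `R_{ijkl,m}` of `∇R` at `z`; `m` is the direction of differentiation. -/
def covCurvature (g : BilinField I M) (z : M) (m u v w t : TangentSpace I z) : ℝ :=
  covRiem (chartBilin g z) (extChartAt I z z) m u v w t

/-- The Ricci tensor `S` at `z`. -/
def ricci [FiniteDimensional ℝ E] (g : BilinField I M) (z : M) :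
    TangentSpace I z →L[ℝ] TangentSpace I z →L[ℝ] ℝ :=
  ric (E := E) (chartBilin g z) (extChartAt I z z)

/-- The trace `g^{ij} h_{ij}` at `z`. -/
def trace [FiniteDimensional ℝ E] (g : BilinField I M) (z : M)
    (h : TangentSpace I z →L[ℝ] TangentSpace I z →L[ℝ] ℝ) : ℝ :=
  metricTrace (E := E) (g z) h

/-- The scalar curvature `κ = g^{jk} S_{jk}` at `z`. -/
def scal [FiniteDimensional ℝ E] (g : BilinField I M) (z : M) : ℝ :=
  trace g z (ricci g z)

/-- The Kulkarni-Nomizu product of two bilinear forms on the tangent space at `z`. -/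
def knAt {z : M} (A B : TangentSpace I z →L[ℝ] TangentSpace I z →L[ℝ] ℝ)
    (u v w t : TangentSpace I z) : ℝ :=
  kn (E := E) A B u v w t

/-! ### Recurrent-like structures -/

/-- The set of the points at which `∇R ≠ ξ ⊗ R` for every covector `ξ`. -/
def nonRecurrentSet (g : BilinField I M) : Set M :=
  {z | ¬ ∃ ξ : TangentSpace I z →L[ℝ] ℝ, ∀ m u v w t,
    covCurvature g z m u v w t = ξ m * curvature g z u v w t}

/-- The set of the points at which
`∇R = Π ⊗ R + Φ ⊗ (S ∧ S) + Ψ ⊗ (g ∧ S) + Θ ⊗ (g ∧ g)`. -/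
def sgkSet [FiniteDimensional ℝ E] (g : BilinField I M) (Pi Phi Psi Theta : CovectorField I M) :
    Set M :=
  {z | ∀ m u v w t, covCurvature g z m u v w t =
    Pi z m * curvature g z u v w t + Phi z m * knAt (ricci g z) (ricci g z) u v w t
      + Psi z m * knAt (g z) (ricci g z) u v w t + Theta z m * knAt (g z) (g z) u v w t}

/-- The set of the points at which `∇R = Π ⊗ R + Φ ⊗ (S ∧ S)`. -/
def wgkSet [FiniteDimensional ℝ E] (g : BilinField I M) (Pi Phi : CovectorField I M) : Set M :=
  {z | ∀ m u v w t, covCurvature g z m u v w t =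
    Pi z m * curvature g z u v w t + Phi z m * knAt (ricci g z) (ricci g z) u v w t}

/-- Super generalized recurrent with associated 1-forms `(Π, Φ, Ψ, Θ)`. -/
structure IsSGK [FiniteDimensional ℝ E] (g : BilinField I M)
    (Pi Phi Psi Theta : CovectorField I M) : Prop where
  smooth_Pi : IsSmoothForm Pi
  smooth_Phi : IsSmoothForm Phi
  smooth_Psi : IsSmoothForm Psi
  smooth_Theta : IsSmoothForm Theta
  subset : nonRecurrentSet g ⊆ sgkSet g Pi Phi Psi Theta

/-- Weakly generalized recurrent with associated 1-forms `(Π, Φ)`. -/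
structure IsWGK [FiniteDimensional ℝ E] (g : BilinField I M) (Pi Phi : CovectorField I M) :
    Prop where
  smooth_Pi : IsSmoothForm Pi
  smooth_Phi : IsSmoothForm Phi
  subset : nonRecurrentSet g ⊆ wgkSet g Pi Phi

end Manifold

/-! ### Warped products -/

section Warped

variable {E₁ : Type*} [NormedAddCommGroup E₁] [NormedSpace ℝ E₁]
  {H₁ : Type*} [TopologicalSpace H₁] {I₁ : ModelWithCorners ℝ E₁ H₁}
  {B : Type*} [TopologicalSpace B] [ChartedSpace H₁ B]
  {E₂ : Type*} [NormedAddCommGroup E₂] [NormedSpace ℝ E₂]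
  {H₂ : Type*} [TopologicalSpace H₂] {I₂ : ModelWithCorners ℝ E₂ H₂}
  {F : Type*} [TopologicalSpace F] [ChartedSpace H₂ F]

/-- The warped product metric `π^* ḡ + (f ∘ π) σ^* g̃` on `B × F`; the tangent space of the
product is the product of the tangent spaces. -/
def warpedMetric (gB : BilinField I₁ B) (f : B → ℝ) (gF : BilinField I₂ F) :
    BilinField (I₁.prod I₂) (B × F) := fun z =>
  ContinuousLinearMap.bilinearComp (E := E₁) (F := E₁) (G := ℝ) (gB z.1)
      (ContinuousLinearMap.fst ℝ E₁ E₂) (ContinuousLinearMap.fst ℝ E₁ E₂) +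
    f z.1 • ContinuousLinearMap.bilinearComp (E := E₂) (F := E₂) (G := ℝ) (gF z.2)
      (ContinuousLinearMap.snd ℝ E₁ E₂) (ContinuousLinearMap.snd ℝ E₁ E₂)

theorem warpedMetric_apply (gB : BilinField I₁ B) (f : B → ℝ) (gF : BilinField I₂ F) (z : B × F)
    (u₁ v₁ : TangentSpace I₁ z.1) (u₂ v₂ : TangentSpace I₂ z.2) :
    warpedMetric gB f gF z (u₁, u₂) (v₁, v₂) = gB z.1 u₁ v₁ + f z.1 * gF z.2 u₂ v₂ := rfl

/-- The part `ᾱ` of a 1-form on `B × F` along the base, on the slice through `y`. -/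
def basePart (α : CovectorField (I₁.prod I₂) (B × F)) (y : F) : CovectorField I₁ B := fun x =>
  ContinuousLinearMap.comp (M₂ := E₁ × E₂) (α (x, y)) (ContinuousLinearMap.inl ℝ E₁ E₂)

/-- The part `α̃` of a 1-form on `B × F` along the fiber, on the slice through `x`. -/
def fiberPart (α : CovectorField (I₁.prod I₂) (B × F)) (x : B) : CovectorField I₂ F := fun y =>
  ContinuousLinearMap.comp (M₂ := E₁ × E₂) (α (x, y)) (ContinuousLinearMap.inr ℝ E₁ E₂)

variable [FiniteDimensional ℝ E₁]

/-- The differential of a function on the base. -/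
def differential (f : B → ℝ) : CovectorField I₁ B := fun x =>
  mfderiv I₁ 𝓘(ℝ, ℝ) f x

/-- `T_{ab} = -(1/(2f)) (∇_b f_a - (1/(2f)) f_a f_b)`. -/
def warpT (gB : BilinField I₁ B) (f : B → ℝ) : BilinField I₁ B := fun x =>
  let df : E₁ →L[ℝ] ℝ := differential (I₁ := I₁) f x
  (-(1 / (2 * f x))) •
    (hess (chartBilin gB x) (f ∘ (extChartAt I₁ x).symm) (extChartAt I₁ x x) -
      (1 / (2 * f x)) • df.smulRight df)

/-- `P = (1/(4f²)) g^{ab} f_a f_b`. -/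
def warpP (gB : BilinField I₁ B) (f : B → ℝ) (x : B) : ℝ :=
  let df : E₁ →L[ℝ] ℝ := differential (I₁ := I₁) f x
  1 / (4 * f x ^ 2) * trace gB x (df.smulRight df)

/-- `Q = f ((q - 1) P - tr T)`, where `q` is the dimension of the fiber. -/
def warpQ (q : ℕ) (gB : BilinField I₁ B) (f : B → ℝ) (x : B) : ℝ :=
  f x * (((q : ℝ) - 1) * warpP gB f x - trace gB x (warpT gB f x))

end Warped

end

end WarpedRecurrent

/-! In a product chart the warped metric is `G₁ + F G₂` on an open set of `E₁ × E₂`, so each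
assertion becomes an identity at one point of a vector space. The mathematics lies in the components
of $R$, $S$ and $\nabla R$ sorted by which arguments are horizontal (base) and which vertical
(fiber): `riem_eq`, `ric_eq` and the `covRiem_*` lemmas. $S$ has no mixed components; it is
$\overline S-qT$ horizontally and $\widetilde S+Q\widetilde g$ vertically. Each assertion reads off
one type of component of $(*)$.

All horizontal gives (i), since $T=\lambda\overline S$ makes the horizontal part of $S$ equal to
$(1-q\lambda)\overline S$. All vertical gives (ii): there $\nabla R=f\,\widetilde\nabla\widetilde
R$, $R=f\widetilde R+\frac12f^2P\,\widetilde g\wedge\widetilde g$, and $(\widetilde S+Q\widetilde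
g)\wedge(\widetilde S+Q\widetilde g)$ is expanded. Nonrecurrent points of a factor must also lift to
nonrecurrent points of $M$; for the fiber this is `fiber_recurrent`.

In (iv), arguments horizontal-vertical-horizontal-vertical make $R$ and $\nabla R$ multiples of
$\widetilde g$, while $S\wedge S$ contains $\widetilde S$, which is therefore a multiple of
$\widetilde g$ (`exists_ric_fiber_eq`). With a vertical derivative and exactly one horizontal
argument, the right side of $(*)$ vanishes, as it does for $\xi\otimes R$, so no point of $M$ is
exempt. The left side is a multiple of $df\,\widetilde R$ plus a multiple of $\widetilde
g\wedge\widetilde g$, with coefficients depending on $x$ alone. Hence $df_x\neq0$ forces constant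
curvature, with neither Schur's lemma nor connectedness.

For (iii), either $df\neq0$ somewhere and the fiber has constant curvature, or $df=0$ everywhere. In
the second case a horizontal derivative of the vertical curvature vanishes, so
$f\,\overline\Pi\otimes\widetilde R+\overline\Phi\otimes\widetilde S\wedge\widetilde S=0$; a smooth
solution for $\widetilde R$ is glued in `exists_roter`. -/

set_option linter.unusedSectionVars false

namespace WarpedRecurrent

/-! ### Levi-Civita calculus of a metric on an open subset of a vector space. -/

section Metric

variable {E : Type*} [NormedAddCommGroup E] [NormedSpace ℝ E]

/-- `G` is a smooth symmetric nondegenerate metric on the open set `U`. -/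
structure IsMetricOn (G : E → E →L[ℝ] E →L[ℝ] ℝ) (U : Set E) : Prop where
  isOpen : IsOpen U
  smooth : ContDiffOn ℝ ∞ G U
  symm : ∀ x ∈ U, ∀ u v, G x u v = G x v u
  nondegenerate : ∀ x ∈ U, ∀ u, (∀ v, G x u v = 0) → u = 0

theorem finrank_continuousDual [FiniteDimensional ℝ E] :
    Module.finrank ℝ (E →L[ℝ] ℝ) = Module.finrank ℝ E := by
  rw [← (LinearMap.toContinuousLinearMap (𝕜 := ℝ) (E := E) (F' := ℝ)).finrank_eq]
  exact Subspace.dual_finrank_eq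

theorem isInvertible_of_nondegenerate [FiniteDimensional ℝ E] {b : E →L[ℝ] E →L[ℝ] ℝ}
    (hb : ∀ u, (∀ v, b u v = 0) → u = 0) : b.IsInvertible := by
  have hinj : Function.Injective (b : E →ₗ[ℝ] E →L[ℝ] ℝ) := by
    refine (injective_iff_map_eq_zero _).2 fun u hu => hb u fun v => ?_
    have : b u = 0 := hu
    simp [this]
  refine ⟨(LinearEquiv.ofInjectiveOfFinrankEq (b : E →ₗ[ℝ] E →L[ℝ] ℝ) hinj
    finrank_continuousDual.symm).toContinuousLinearEquiv, ?_⟩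
  ext u v
  rfl

theorem fderiv_eval {V : Type*} [NormedAddCommGroup V] [NormedSpace ℝ V]
    {W : Type*} [NormedAddCommGroup W] [NormedSpace ℝ W] {A : E → V →L[ℝ] W} {x : E}
    (hA : DifferentiableAt ℝ A x) (u : E) (v : V) :
    fderiv ℝ A x u v = fderiv ℝ (fun y => A y v) x u := by
  rw [fderiv_clm_apply hA (differentiableAt_const v)]
  simp

theorem fderiv_eval₂ {V : Type*} [NormedAddCommGroup V] [NormedSpace ℝ V]
    {W : Type*} [NormedAddCommGroup W] [NormedSpace ℝ W]
    {X : Type*} [NormedAddCommGroup X] [NormedSpace ℝ X] {A : E → V →L[ℝ] W →L[ℝ] X} {x : E}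
    (hA : DifferentiableAt ℝ A x) (u : E) (v : V) (w : W) :
    fderiv ℝ A x u v w = fderiv ℝ (fun y => A y v w) x u := by
  rw [fderiv_eval hA, fderiv_eval (hA.clm_apply (differentiableAt_const v))]

namespace IsMetricOn

variable {G : E → E →L[ℝ] E →L[ℝ] ℝ} {U : Set E} (h : IsMetricOn G U) {x : E} (hx : x ∈ U)
include h hx

theorem mem_nhds : U ∈ nhds x := h.isOpen.mem_nhds hx

theorem contDiffAt : ContDiffAt ℝ ∞ G x := h.smooth.contDiffAt (h.mem_nhds hx)

theorem differentiableAt : DifferentiableAt ℝ G x :=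
  (h.contDiffAt hx).differentiableAt (by simp)

theorem contDiffAt_fderiv : ContDiffAt ℝ ∞ (fderiv ℝ G) x :=
  (h.contDiffAt hx).fderiv_right (m := ∞) (by simp)

/-- Vector identities are proved below with an index lowered, where the inverse metric no longer
appears. -/
theorem ext_of_lower {u v : E} (huv : ∀ w, G x u w = G x v w) : u = v := by
  refine sub_eq_zero.1 (h.nondegenerate x hx _ fun w => ?_)
  simp [huv w]

theorem fderiv_symm (u v w : E) : fderiv ℝ G x u v w = fderiv ℝ G x u w v := by
  rw [fderiv_eval₂ (h.differentiableAt hx), fderiv_eval₂ (h.differentiableAt hx)]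
  congr 1
  apply Filter.EventuallyEq.fderiv_eq
  filter_upwards [h.mem_nhds hx] with y hy using h.symm y hy v w

theorem contDiffAt_christoffelFirst : ContDiffAt ℝ ∞ (christoffelFirst G) x := by
  have hD := h.contDiffAt_fderiv hx
  unfold christoffelFirst rot
  have hflip : ContDiffAt ℝ ∞ (fun y => (fderiv ℝ G y).flip) x :=
    (ContinuousLinearMap.flipₗᵢ ℝ E E (E →L[ℝ] ℝ)).toContinuousLinearEquiv.contDiff.contDiffAt.comp
      x hD
  exact ContDiffAt.const_smul (1 / 2 : ℝ)
    ((hD.add hflip).sub (contDiffAt_const.clm_comp hflip))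

variable [FiniteDimensional ℝ E]

theorem isInvertible : (G x).IsInvertible :=
  isInvertible_of_nondegenerate (h.nondegenerate x hx)

theorem apply_inverse (φ : E →L[ℝ] ℝ) : G x ((G x).inverse φ) = φ :=
  (h.isInvertible hx).self_apply_inverse φ

theorem contDiffAt_inverse : ContDiffAt ℝ ∞ (fun y => (G y).inverse) x :=
  have : CompleteSpace E := FiniteDimensional.complete ℝ E
  ((h.isInvertible hx).contDiffAt_map_inverse).comp x (h.contDiffAt hx)

theorem lower_christoffel (u v w : E) :
    G x (christoffel G x u v) w = christoffelFirst G x u v w := by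
  rw [christoffel_apply, h.apply_inverse hx]

theorem christoffel_symm (u v : E) : christoffel G x u v = christoffel G x v u := by
  refine h.ext_of_lower hx fun w => ?_
  rw [h.lower_christoffel hx, h.lower_christoffel hx, christoffelFirst_apply,
    christoffelFirst_apply, h.fderiv_symm hx w u v]
  ring

/-- Compatibility of the connection with the metric, $\nabla g=0$. -/
theorem fderiv_eq_christoffel (u v w : E) :
    fderiv ℝ G x u v w = G x (christoffel G x u v) w + G x (christoffel G x u w) v := by
  rw [h.lower_christoffel hx, h.lower_christoffel hx, christoffelFirst_apply,
    christoffelFirst_apply, h.fderiv_symm hx u w v, h.fderiv_symm hx w u v,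
    h.fderiv_symm hx v u w]
  ring

theorem contDiffAt_christoffel : ContDiffAt ℝ ∞ (christoffel G) x := by
  unfold christoffel
  exact ((ContinuousLinearMap.compL ℝ E (E →L[ℝ] ℝ) E).contDiff.contDiffAt.comp x
    (h.contDiffAt_inverse hx)).clm_comp (h.contDiffAt_christoffelFirst hx)

theorem differentiableAt_christoffel : DifferentiableAt ℝ (christoffel G) x :=
  (h.contDiffAt_christoffel hx).differentiableAt (by simp)

theorem contDiffAt_riem (u v w t : E) : ContDiffAt ℝ ∞ (fun y => riem G y u v w t) x := by
  have hG := h.contDiffAt hx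
  have hC := h.contDiffAt_christoffel hx
  have hD : ContDiffAt ℝ ∞ (fderiv ℝ (christoffel G)) x := hC.fderiv_right (m := ∞) (by simp)
  unfold riem
  simp only [curvOp_apply]
  fun_prop

theorem differentiableAt_riem (u v w t : E) :
    DifferentiableAt ℝ (fun y => riem G y u v w t) x :=
  (h.contDiffAt_riem hx u v w t).differentiableAt (by simp)

end IsMetricOn

end Metric

/-! ### The connection of a warped product and its first derivative. -/

section WarpedModel

/-- The metric gradient of a function. -/
noncomputable def grad {E : Type*} [NormedAddCommGroup E] [NormedSpace ℝ E]
    (G : E → E →L[ℝ] E →L[ℝ] ℝ) (F : E → ℝ) (x : E) : E := (G x).inverse (fderiv ℝ F x)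

variable {E₁ : Type*} [NormedAddCommGroup E₁] [NormedSpace ℝ E₁]
  {E₂ : Type*} [NormedAddCommGroup E₂] [NormedSpace ℝ E₂]

/-- `G` is the warped product metric `G₁ + F G₂` on the open set `U₁ × U₂`. -/
structure IsWarpedOn (G : E₁ × E₂ → E₁ × E₂ →L[ℝ] E₁ × E₂ →L[ℝ] ℝ)
    (G₁ : E₁ → E₁ →L[ℝ] E₁ →L[ℝ] ℝ) (F : E₁ → ℝ) (G₂ : E₂ → E₂ →L[ℝ] E₂ →L[ℝ] ℝ)
    (U₁ : Set E₁) (U₂ : Set E₂) : Prop where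
  base : IsMetricOn G₁ U₁
  fiber : IsMetricOn G₂ U₂
  smooth : ContDiffOn ℝ ∞ F U₁
  pos : ∀ x ∈ U₁, 0 < F x
  eq : ∀ x ∈ U₁, ∀ y ∈ U₂, ∀ u v,
    G (x, y) u v = G₁ x u.1 v.1 + F x * G₂ y u.2 v.2

theorem fderiv_comp_fst {W : Type*} [NormedAddCommGroup W] [NormedSpace ℝ W] {a : E₁ → W}
    {x : E₁} {y : E₂} (ha : DifferentiableAt ℝ a x) (u : E₁ × E₂) :
    fderiv ℝ (fun p : E₁ × E₂ => a p.1) (x, y) u = fderiv ℝ a x u.1 := by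
  have := (HasFDerivAt.comp (x, y) (f := Prod.fst) ha.hasFDerivAt
    (hasFDerivAt_fst (𝕜 := ℝ) (E := E₁) (F := E₂))).fderiv
  exact congrArg (fun L => L u) this

theorem fderiv_comp_snd {W : Type*} [NormedAddCommGroup W] [NormedSpace ℝ W] {a : E₂ → W}
    {x : E₁} {y : E₂} (ha : DifferentiableAt ℝ a y) (u : E₁ × E₂) :
    fderiv ℝ (fun p : E₁ × E₂ => a p.2) (x, y) u = fderiv ℝ a y u.2 := by
  have := (HasFDerivAt.comp (x, y) (f := Prod.snd) ha.hasFDerivAt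
    (hasFDerivAt_snd (𝕜 := ℝ) (E := E₁) (F := E₂))).fderiv
  exact congrArg (fun L => L u) this

theorem fderiv_along_base {W : Type*} [NormedAddCommGroup W] [NormedSpace ℝ W]
    {a : E₁ × E₂ → W} {x : E₁} {y : E₂} (ha : DifferentiableAt ℝ a (x, y)) (u : E₁) :
    fderiv ℝ a (x, y) (u, 0) = fderiv ℝ (fun x' => a (x', y)) x u := by
  have := (HasFDerivAt.comp x (f := fun x' => (x', y)) ha.hasFDerivAt
    (hasFDerivAt_prodMk_left x y)).fderiv
  exact (congrArg (fun L => L u) this).symm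

theorem fderiv_along_fiber {W : Type*} [NormedAddCommGroup W] [NormedSpace ℝ W]
    {a : E₁ × E₂ → W} {x : E₁} {y : E₂} (ha : DifferentiableAt ℝ a (x, y)) (u : E₂) :
    fderiv ℝ a (x, y) (0, u) = fderiv ℝ (fun y' => a (x, y')) y u := by
  have := (HasFDerivAt.comp y (f := fun y' => (x, y')) ha.hasFDerivAt
    (hasFDerivAt_prodMk_right x y)).fderiv
  exact (congrArg (fun L => L u) this).symm

/-- The tensor `T` of a warping function. -/
noncomputable def modelT (G : E₁ → E₁ →L[ℝ] E₁ →L[ℝ] ℝ) (F : E₁ → ℝ) (x : E₁) :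
    E₁ →L[ℝ] E₁ →L[ℝ] ℝ :=
  (-(1 / (2 * F x))) •
    (hess G F x - (1 / (2 * F x)) • (fderiv ℝ F x).smulRight (fderiv ℝ F x))

theorem hess_apply (G : E₁ → E₁ →L[ℝ] E₁ →L[ℝ] ℝ) (F : E₁ → ℝ) (x u v : E₁) :
    hess G F x u v = fderiv ℝ (fderiv ℝ F) x u v - fderiv ℝ F x (christoffel G x u v) := rfl

theorem modelT_apply (G : E₁ → E₁ →L[ℝ] E₁ →L[ℝ] ℝ) (F : E₁ → ℝ) (x u v : E₁) :
    modelT G F x u v = -(1 / (2 * F x)) * (fderiv ℝ (fderiv ℝ F) x u v -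
      fderiv ℝ F x (christoffel G x u v) -
      1 / (2 * F x) * (fderiv ℝ F x u * fderiv ℝ F x v)) := rfl

variable [FiniteDimensional ℝ E₁] [FiniteDimensional ℝ E₂]

namespace IsWarpedOn

variable {G : E₁ × E₂ → E₁ × E₂ →L[ℝ] E₁ × E₂ →L[ℝ] ℝ}
  {G₁ : E₁ → E₁ →L[ℝ] E₁ →L[ℝ] ℝ} {F : E₁ → ℝ} {G₂ : E₂ → E₂ →L[ℝ] E₂ →L[ℝ] ℝ}
  {U₁ : Set E₁} {U₂ : Set E₂} (h : IsWarpedOn G G₁ F G₂ U₁ U₂)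

include h

theorem isMetricOn : IsMetricOn G (U₁ ×ˢ U₂) where
  isOpen := h.base.isOpen.prod h.fiber.isOpen
  smooth := by
    refine contDiffOn_clm_apply.2 fun u => contDiffOn_clm_apply.2 fun v => ?_
    have h1 : ContDiffOn ℝ ∞ (fun p : E₁ × E₂ => G₁ p.1) (U₁ ×ˢ U₂) :=
      h.base.smooth.comp contDiffOn_fst fun p hp => hp.1
    have h2 : ContDiffOn ℝ ∞ (fun p : E₁ × E₂ => G₂ p.2) (U₁ ×ˢ U₂) :=
      h.fiber.smooth.comp contDiffOn_snd fun p hp => hp.2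
    have h3 : ContDiffOn ℝ ∞ (fun p : E₁ × E₂ => F p.1) (U₁ ×ˢ U₂) :=
      h.smooth.comp contDiffOn_fst fun p hp => hp.1
    refine ContDiffOn.congr (f := fun p => G₁ p.1 u.1 v.1 + F p.1 * G₂ p.2 u.2 v.2) ?_
      fun p hp => h.eq p.1 hp.1 p.2 hp.2 u v
    exact ((h1.clm_apply contDiffOn_const).clm_apply contDiffOn_const).add
      (h3.mul ((h2.clm_apply contDiffOn_const).clm_apply contDiffOn_const))
  symm := fun p hp u v => by
    have e := h.eq p.1 hp.1 p.2 hp.2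
    rw [e u v, e v u, h.base.symm _ hp.1, h.fiber.symm _ hp.2]
  nondegenerate := fun p hp u hu => by
    have e := h.eq p.1 hp.1 p.2 hp.2
    refine Prod.ext (h.base.nondegenerate _ hp.1 _ fun v => ?_)
      (h.fiber.nondegenerate _ hp.2 _ fun v => ?_)
    · have := (e u (v, 0)).symm.trans (hu (v, 0))
      simpa using this
    · have := (e u (0, v)).symm.trans (hu (0, v))
      simpa [(h.pos _ hp.1).ne'] using this

variable {x : E₁} {y : E₂} (hx : x ∈ U₁)
include hx

theorem contDiffAt_F : ContDiffAt ℝ ∞ F x := h.smooth.contDiffAt (h.base.mem_nhds hx)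

theorem contDiffAt_fderiv_F : ContDiffAt ℝ ∞ (fderiv ℝ F) x :=
  (h.contDiffAt_F hx).fderiv_right (m := ∞) (by simp)

theorem differentiableAt_F : DifferentiableAt ℝ F x :=
  (h.contDiffAt_F hx).differentiableAt (by simp)

theorem differentiableAt_fderiv_F : DifferentiableAt ℝ (fderiv ℝ F) x :=
  (h.contDiffAt_fderiv_F hx).differentiableAt (by simp)

theorem differentiableAt_grad : DifferentiableAt ℝ (grad G₁ F) x :=
  ((h.base.contDiffAt_inverse hx).clm_apply (h.contDiffAt_fderiv_F hx)).differentiableAt (by simp)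

theorem lower_grad (w : E₁) : G₁ x (grad G₁ F x) w = fderiv ℝ F x w := by
  rw [grad, h.base.apply_inverse hx]

/-- This is $g(\nabla_u\,\mathrm{grad}F,w)=\mathrm{Hess}F(u,w)$, obtained by differentiating
$g(\mathrm{grad}F,w)=dF(w)$ and using $\nabla g=0$. -/
theorem lower_fderiv_grad (u w : E₁) :
    G₁ x (fderiv ℝ (grad G₁ F) x u) w =
      hess G₁ F x u w - G₁ x (christoffel G₁ x u (grad G₁ F x)) w := by
  have e : (fun y => G₁ y (grad G₁ F y) w) =ᶠ[nhds x] fun y => fderiv ℝ F y w := by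
    filter_upwards [h.base.mem_nhds hx] with y hy using h.lower_grad hy w
  have e' : fderiv ℝ (fun y => G₁ y (grad G₁ F y) w) x u =
      fderiv ℝ (fun y => fderiv ℝ F y w) x u := by rw [e.fderiv_eq]
  have hG := h.base.differentiableAt hx
  have hK := h.differentiableAt_grad hx
  rw [← fderiv_eval (h.differentiableAt_fderiv_F hx),
    ← fderiv_eval (hG.clm_apply hK), fderiv_clm_apply hG hK] at e'
  simp only [add_apply, ContinuousLinearMap.comp_apply,
    ContinuousLinearMap.flip_apply] at e'
  rw [h.base.fderiv_eq_christoffel hx, h.base.symm x hx _ (grad G₁ F x), h.lower_grad hx] at e'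
  rw [hess_apply]
  linarith

variable (hy : y ∈ U₂)
include hy

theorem mem_nhds : U₁ ×ˢ U₂ ∈ nhds (x, y) := h.isMetricOn.mem_nhds ⟨hx, hy⟩

theorem fderiv_apply (u v w : E₁ × E₂) :
    fderiv ℝ G (x, y) u v w = fderiv ℝ G₁ x u.1 v.1 w.1 +
      fderiv ℝ F x u.1 * G₂ y v.2 w.2 + F x * fderiv ℝ G₂ y u.2 v.2 w.2 := by
  rw [fderiv_eval₂ (h.isMetricOn.differentiableAt ⟨hx, hy⟩)]
  have e : (fun p => G p v w) =ᶠ[nhds (x, y)]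
      fun p => G₁ p.1 v.1 w.1 + F p.1 * G₂ p.2 v.2 w.2 := by
    filter_upwards [h.mem_nhds hx hy] with p hp using h.eq p.1 hp.1 p.2 hp.2 v w
  have d1 : DifferentiableAt ℝ (fun x => G₁ x v.1 w.1) x := by
    have := h.base.differentiableAt hx
    fun_prop
  have d2 : DifferentiableAt ℝ (fun y => G₂ y v.2 w.2) y := by
    have := h.fiber.differentiableAt hy
    fun_prop
  have d3 := h.differentiableAt_F hx
  have D1 : DifferentiableAt ℝ (fun p : E₁ × E₂ => G₁ p.1 v.1 w.1) (x, y) :=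
    DifferentiableAt.comp (x, y) (g := fun x => G₁ x v.1 w.1) d1 differentiableAt_fst
  have D2 : DifferentiableAt ℝ (fun p : E₁ × E₂ => G₂ p.2 v.2 w.2) (x, y) :=
    DifferentiableAt.comp (x, y) (g := fun y => G₂ y v.2 w.2) d2 differentiableAt_snd
  have D3 : DifferentiableAt ℝ (fun p : E₁ × E₂ => F p.1) (x, y) :=
    DifferentiableAt.comp (x, y) (g := F) d3 differentiableAt_fst
  rw [e.fderiv_eq, fderiv_fun_add D1 (D3.fun_mul D2), fderiv_fun_mul D3 D2]
  simp only [add_apply, smul_apply, smul_eq_mul]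
  rw [fderiv_comp_fst d1, fderiv_comp_fst d3, fderiv_comp_snd d2,
    ← fderiv_eval₂ (h.base.differentiableAt hx), ← fderiv_eval₂ (h.fiber.differentiableAt hy)]
  ring

/-- The Levi-Civita connection of a warped product. -/
theorem christoffel_eq (u v : E₁ × E₂) :
    christoffel G (x, y) u v =
      (christoffel G₁ x u.1 v.1 - (1 / 2 * G₂ y u.2 v.2) • grad G₁ F x,
       christoffel G₂ y u.2 v.2 +
        (1 / (2 * F x)) • (fderiv ℝ F x u.1 • v.2 + fderiv ℝ F x v.1 • u.2)) := by
  refine h.isMetricOn.ext_of_lower (x := (x, y)) ⟨hx, hy⟩ fun w => ?_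
  have hF := (h.pos x hx).ne'
  rw [h.isMetricOn.lower_christoffel ⟨hx, hy⟩, christoffelFirst_apply, h.fderiv_apply hx hy,
    h.fderiv_apply hx hy, h.fderiv_apply hx hy, h.eq x hx y hy]
  simp only [map_sub, map_add, map_smul, sub_apply,
    add_apply, smul_apply, smul_eq_mul,
    h.base.lower_christoffel hx, h.fiber.lower_christoffel hy, christoffelFirst_apply,
    h.lower_grad hx, h.fiber.symm y hy u.2 w.2]
  field_simp
  ring

theorem fderiv_christoffel (u v w : E₁ × E₂) :
    fderiv ℝ (christoffel G) (x, y) u v w =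
      (fderiv ℝ (christoffel G₁) x u.1 v.1 w.1
          - (1 / 2 * G₂ y v.2 w.2) • fderiv ℝ (grad G₁ F) x u.1
          - (1 / 2 * fderiv ℝ G₂ y u.2 v.2 w.2) • grad G₁ F x,
       fderiv ℝ (christoffel G₂) y u.2 v.2 w.2
        + (1 / (2 * F x)) • (fderiv ℝ (fderiv ℝ F) x u.1 v.1 • w.2
            + fderiv ℝ (fderiv ℝ F) x u.1 w.1 • v.2)
        - (fderiv ℝ F x u.1 / (2 * F x ^ 2)) •
            (fderiv ℝ F x v.1 • w.2 + fderiv ℝ F x w.1 • v.2)) := by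
  have hF := (h.pos x hx).ne'
  rw [fderiv_eval₂ (h.isMetricOn.differentiableAt_christoffel ⟨hx, hy⟩)]
  have e : (fun p => christoffel G p v w) =ᶠ[nhds (x, y)] fun p =>
      (christoffel G₁ p.1 v.1 w.1 - (1 / 2 * G₂ p.2 v.2 w.2) • grad G₁ F p.1,
       christoffel G₂ p.2 v.2 w.2 +
        (1 / (2 * F p.1)) • (fderiv ℝ F p.1 v.1 • w.2 + fderiv ℝ F p.1 w.1 • v.2)) := by
    filter_upwards [h.mem_nhds hx hy] with p hp using h.christoffel_eq hp.1 hp.2 v w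
  rw [e.fderiv_eq]
  have c1 := h.base.differentiableAt_christoffel hx
  have c2 := h.fiber.differentiableAt_christoffel hy
  have g2 := h.fiber.differentiableAt hy
  have k := (h.differentiableAt_grad hx).hasFDerivAt
  have f0 := (h.differentiableAt_F hx).hasFDerivAt
  have f1 := h.differentiableAt_fderiv_F hx
  have hfst := hasFDerivAt_fst (𝕜 := ℝ) (E := E₁) (F := E₂) (p := (x, y))
  have hsnd := hasFDerivAt_snd (𝕜 := ℝ) (E := E₁) (F := E₂) (p := (x, y))
  have C1 := HasFDerivAt.comp (x, y) (f := Prod.fst)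
    (show DifferentiableAt ℝ (fun x => christoffel G₁ x v.1 w.1) x by fun_prop).hasFDerivAt hfst
  have C2 := HasFDerivAt.comp (x, y) (f := Prod.snd)
    (show DifferentiableAt ℝ (fun y => christoffel G₂ y v.2 w.2) y by fun_prop).hasFDerivAt hsnd
  have A2 := HasFDerivAt.comp (x, y) (f := Prod.snd)
    (show DifferentiableAt ℝ (fun y => G₂ y v.2 w.2) y by fun_prop).hasFDerivAt hsnd
  have K := HasFDerivAt.comp (x, y) (f := Prod.fst) k hfst
  have F0 := HasFDerivAt.comp (x, y) (f := Prod.fst) 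
    ((hasDerivAt_inv (show 2 * F x ≠ 0 by simpa using hF)).comp_hasFDerivAt x (f0.const_mul 2)) hfst
  have F1 := HasFDerivAt.comp (x, y) (f := Prod.fst)
    (show DifferentiableAt ℝ (fun x => fderiv ℝ F x v.1) x by fun_prop).hasFDerivAt hfst
  have F2 := HasFDerivAt.comp (x, y) (f := Prod.fst)
    (show DifferentiableAt ℝ (fun x => fderiv ℝ F x w.1) x by fun_prop).hasFDerivAt hfst
  -- The closed form `christoffel_eq`, rebuilt term by term as a composite of maps with known
  -- derivatives.
  have key := ((C1.sub ((A2.const_mul (1 / 2)).smul K)).prodMk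
    (C2.add (F0.smul ((F1.smul_const w.2).add (F2.smul_const v.2)))))
  have key' := key.fderiv
  simp only [Function.comp_def, ← one_div] at key'
  refine (congrArg (fun L => L u) key').trans ?_
  simp only [fderiv_eval₂ c1, fderiv_eval₂ c2, fderiv_eval₂ g2, fderiv_eval f1]
  refine Prod.ext ?_ ?_
  · simp
    module
  · simp
    module

end IsWarpedOn

end WarpedModel

/-! ### The curvature and Ricci tensors of a warped product. -/

section WarpedCurvature

variable {E₁ : Type*} [NormedAddCommGroup E₁] [NormedSpace ℝ E₁] [FiniteDimensional ℝ E₁]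
  {E₂ : Type*} [NormedAddCommGroup E₂] [NormedSpace ℝ E₂] [FiniteDimensional ℝ E₂]

namespace IsWarpedOn

variable {G : E₁ × E₂ → E₁ × E₂ →L[ℝ] E₁ × E₂ →L[ℝ] ℝ}
  {G₁ : E₁ → E₁ →L[ℝ] E₁ →L[ℝ] ℝ} {F : E₁ → ℝ} {G₂ : E₂ → E₂ →L[ℝ] E₂ →L[ℝ] ℝ}
  {U₁ : Set E₁} {U₂ : Set E₂} (h : IsWarpedOn G G₁ F G₂ U₁ U₂)
  {x : E₁} {y : E₂} (hx : x ∈ U₁) (hy : y ∈ U₂)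
include h hx

theorem fderiv_fderiv_symm (u v : E₁) :
    fderiv ℝ (fderiv ℝ F) x u v = fderiv ℝ (fderiv ℝ F) x v u :=
  ((h.contDiffAt_F hx).isSymmSndFDerivAt (by simpa using WithTop.coe_le_coe.2 (le_top (a := (2 : ℕ∞))))).eq u v

include hy

/-- The curvature tensor of a warped product. -/
theorem riem_eq (u v w t : E₁ × E₂) :
    riem G (x, y) u v w t = riem G₁ x u.1 v.1 w.1 t.1 + F x * riem G₂ y u.2 v.2 w.2 t.2
      + fderiv ℝ F x (grad G₁ F x) / 8 * kn (G₂ y) (G₂ y) u.2 v.2 w.2 t.2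
      - F x * (modelT G₁ F x u.1 t.1 * G₂ y v.2 w.2 + modelT G₁ F x v.1 w.1 * G₂ y u.2 t.2
        - modelT G₁ F x u.1 w.1 * G₂ y v.2 t.2 - modelT G₁ F x v.1 t.1 * G₂ y u.2 w.2) := by
  have hF := (h.pos x hx).ne'
  -- Terms without a counterpart in the formula cancel by symmetry of second derivatives, of the
  -- Christoffel symbols and of the metric.
  have s1 := h.fderiv_fderiv_symm hx u.1 v.1
  have s3 := h.fiber.christoffel_symm hy u.2 v.2
  have s4 := h.fiber.symm y hy u.2 v.2
  have s5 := h.fiber.symm y hy (christoffel G₂ y u.2 w.2) v.2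
  have s6 := h.fiber.symm y hy (christoffel G₂ y v.2 w.2) u.2
  unfold riem
  simp only [curvOp_apply, h.eq x hx y hy, h.fderiv_christoffel hx hy, h.christoffel_eq hx hy,
    map_sub, map_add, map_smul,
    sub_apply, add_apply, smul_apply, smul_eq_mul, h.lower_grad hx, h.lower_fderiv_grad hx,
    h.fiber.fderiv_eq_christoffel hy, hess_apply, modelT_apply, kn, s1, s3, s4, s5, s6]
  field_simp
  ring

/-- This and `snd_curvOp` are the two diagonal blocks of the operator whose trace is the Ricci
tensor; raising the last index in `riem_eq` yields them. -/
theorem fst_curvOp (u : E₁) (v w : E₁ × E₂) :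
    (curvOp G (x, y) (u, 0) v w).1 = curvOp G₁ x u v.1 w.1 -
      (F x * G₂ y v.2 w.2) • (G₁ x).inverse (modelT G₁ F x u) := by
  refine h.base.ext_of_lower hx fun t => ?_
  have e := h.riem_eq hx hy (u, 0) v w (t, 0)
  rw [riem, h.eq x hx y hy] at e
  simp only [map_zero, mul_zero, add_zero, kn, riem, zero_apply, zero_mul, sub_zero]
    at e
  simp only [map_sub, map_smul, sub_apply, smul_apply, smul_eq_mul, h.base.apply_inverse hx, e]
  ring

theorem snd_curvOp (u : E₂) (v w : E₁ × E₂) :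
    (curvOp G (x, y) (0, u) v w).2 = curvOp G₂ y u v.2 w.2 +
      (fderiv ℝ F x (grad G₁ F x) / (4 * F x)) • (G₂ y v.2 w.2 • u - G₂ y u w.2 • v.2) -
      modelT G₁ F x v.1 w.1 • u := by
  have hF := (h.pos x hx).ne'
  refine h.fiber.ext_of_lower hy fun t => mul_left_cancel₀ hF ?_
  have e := h.riem_eq hx hy (0, u) v w (0, t)
  rw [riem, h.eq x hx y hy] at e
  simp only [map_zero, kn, riem, zero_apply, zero_mul, sub_zero, zero_add]
    at e
  simp only [map_sub, map_add, map_smul, sub_apply, add_apply, smul_apply, smul_eq_mul, e]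
  field_simp
  ring

end IsWarpedOn

theorem trace_prod (L : E₁ × E₂ →ₗ[ℝ] E₁ × E₂) :
    LinearMap.trace ℝ (E₁ × E₂) L =
      LinearMap.trace ℝ E₁ (LinearMap.fst ℝ E₁ E₂ ∘ₗ L ∘ₗ LinearMap.inl ℝ E₁ E₂) +
      LinearMap.trace ℝ E₂ (LinearMap.snd ℝ E₁ E₂ ∘ₗ L ∘ₗ LinearMap.inr ℝ E₁ E₂) := by
  have e : L = LinearMap.inl ℝ E₁ E₂ ∘ₗ (LinearMap.fst ℝ E₁ E₂ ∘ₗ L) +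
      LinearMap.inr ℝ E₁ E₂ ∘ₗ (LinearMap.snd ℝ E₁ E₂ ∘ₗ L) := by
    ext u <;> simp
  conv_lhs => rw [e]
  rw [map_add, LinearMap.trace_comp_comm', LinearMap.trace_comp_comm' _ (LinearMap.inr ℝ E₁ E₂)]
  rfl

namespace IsWarpedOn

variable {G : E₁ × E₂ → E₁ × E₂ →L[ℝ] E₁ × E₂ →L[ℝ] ℝ}
  {G₁ : E₁ → E₁ →L[ℝ] E₁ →L[ℝ] ℝ} {F : E₁ → ℝ} {G₂ : E₂ → E₂ →L[ℝ] E₂ →L[ℝ] ℝ}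
  {U₁ : Set E₁} {U₂ : Set E₂} (h : IsWarpedOn G G₁ F G₂ U₁ U₂)
  {x : E₁} {y : E₂} (hx : x ∈ U₁) (hy : y ∈ U₂)
include h hx hy

/-- The Ricci tensor of a warped product. -/
theorem ric_eq (v w : E₁ × E₂) :
    ric G (x, y) v w = ric G₁ x v.1 w.1 - Module.finrank ℝ E₂ * modelT G₁ F x v.1 w.1 +
      (ric G₂ y v.2 w.2 + F x * (((Module.finrank ℝ E₂ : ℝ) - 1) *
        (fderiv ℝ F x (grad G₁ F x) / (4 * F x ^ 2)) - metricTrace (G₁ x) (modelT G₁ F x)) *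
          G₂ y v.2 w.2) := by
  have hF := (h.pos x hx).ne'
  rw [ric_apply, trace_prod]
  have e1 : LinearMap.fst ℝ E₁ E₂ ∘ₗ
      ((((curvOp G (x, y)).flip v).flip w : E₁ × E₂ →L[ℝ] E₁ × E₂) : E₁ × E₂ →ₗ[ℝ] E₁ × E₂) ∘ₗ
        LinearMap.inl ℝ E₁ E₂ =
      ((((curvOp G₁ x).flip v.1).flip w.1 : E₁ →L[ℝ] E₁) : E₁ →ₗ[ℝ] E₁) -
        (F x * G₂ y v.2 w.2) • (((G₁ x).inverse.comp (modelT G₁ F x) : E₁ →L[ℝ] E₁) :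
          E₁ →ₗ[ℝ] E₁) := by
    ext u
    exact h.fst_curvOp hx hy u v w
  have e2 : LinearMap.snd ℝ E₁ E₂ ∘ₗ
      ((((curvOp G (x, y)).flip v).flip w : E₁ × E₂ →L[ℝ] E₁ × E₂) : E₁ × E₂ →ₗ[ℝ] E₁ × E₂) ∘ₗ
        LinearMap.inr ℝ E₁ E₂ =
      ((((curvOp G₂ y).flip v.2).flip w.2 : E₂ →L[ℝ] E₂) : E₂ →ₗ[ℝ] E₂) +
        (fderiv ℝ F x (grad G₁ F x) / (4 * F x)) • (G₂ y v.2 w.2 • LinearMap.id -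
          LinearMap.smulRight ((((G₂ y).flip w.2 : E₂ →L[ℝ] ℝ)) : E₂ →ₗ[ℝ] ℝ) v.2) -
        modelT G₁ F x v.1 w.1 • LinearMap.id := by
    ext u
    exact h.snd_curvOp hx hy u v w
  -- On the fiber block the identity has trace $q$ and the rank one term has trace $\widetilde
  -- g(v,w)$, whence the factor $q-1$.
  rw [e1, e2]
  simp only [map_sub, map_add, map_smul, LinearMap.trace_id, LinearMap.trace_smulRight,
    smul_eq_mul]
  rw [← ric_apply, ← ric_apply]
  simp only [metricTrace, traceCLM, ContinuousLinearMap.coe_coe, ContinuousLinearMap.flip_apply,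
    LinearMap.coe_toContinuousLinearMap', LinearMap.comp_apply, ContinuousLinearMap.coeLM_apply]
  field_simp
  ring

end IsWarpedOn

end WarpedCurvature

/-! ### Components of $\nabla R$ by horizontal and vertical type. -/

section WarpedCovariantDerivative

variable {E₁ : Type*} [NormedAddCommGroup E₁] [NormedSpace ℝ E₁] [FiniteDimensional ℝ E₁]
  {E₂ : Type*} [NormedAddCommGroup E₂] [NormedSpace ℝ E₂] [FiniteDimensional ℝ E₂]

namespace IsWarpedOn

variable {G : E₁ × E₂ → E₁ × E₂ →L[ℝ] E₁ × E₂ →L[ℝ] ℝ}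
  {G₁ : E₁ → E₁ →L[ℝ] E₁ →L[ℝ] ℝ} {F : E₁ → ℝ} {G₂ : E₂ → E₂ →L[ℝ] E₂ →L[ℝ] ℝ}
  {U₁ : Set E₁} {U₂ : Set E₂} (h : IsWarpedOn G G₁ F G₂ U₁ U₂)
  {x : E₁} {y : E₂} (hx : x ∈ U₁) (hy : y ∈ U₂)
include h hx hy

theorem riem_base (u v w t : E₁) :
    riem G (x, y) (u, 0) (v, 0) (w, 0) (t, 0) = riem G₁ x u v w t := by
  rw [h.riem_eq hx hy]
  simp [riem, kn]

theorem riem_fiber (u v w t : E₂) :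
    riem G (x, y) (0, u) (0, v) (0, w) (0, t) = F x * riem G₂ y u v w t
      + fderiv ℝ F x (grad G₁ F x) / 8 * kn (G₂ y) (G₂ y) u v w t := by
  rw [h.riem_eq hx hy]
  simp [riem]

theorem riem_mixed (u : E₁) (v : E₂) (w : E₁) (t : E₂) :
    riem G (x, y) (u, 0) (0, v) (w, 0) (0, t) = F x * modelT G₁ F x u w * G₂ y v t := by
  rw [h.riem_eq hx hy]
  simp [riem, kn]
  ring

theorem riem_base_fiber (u : E₁) (v w t : E₂) :
    riem G (x, y) (u, 0) (0, v) (0, w) (0, t) = 0 := by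
  rw [h.riem_eq hx hy]
  simp [riem, kn]

theorem covRiem_base (m u v w t : E₁) :
    covRiem G (x, y) (m, 0) (u, 0) (v, 0) (w, 0) (t, 0) = covRiem G₁ x m u v w t := by
  have e : (fun x' => riem G (x', y) (u, 0) (v, 0) (w, 0) (t, 0)) =ᶠ[nhds x]
      fun x' => riem G₁ x' u v w t := by
    filter_upwards [h.base.mem_nhds hx] with x' hx' using h.riem_base hx' hy u v w t
  rw [covRiem, fderiv_along_base (h.isMetricOn.differentiableAt_riem ⟨hx, hy⟩ _ _ _ _),
    e.fderiv_eq]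
  simp only [h.christoffel_eq hx hy, map_zero, mul_zero, zero_smul, sub_zero, smul_zero,
    add_zero, h.riem_base hx hy, covRiem]

/-- The $\widetilde g\wedge\widetilde g$ term of `riem_fiber` is parallel along the fiber, and the
horizontal parts of the connection only meet components of $R$ with one horizontal argument, which
vanish. -/
theorem covRiem_fiber (m u v w t : E₂) :
    covRiem G (x, y) (0, m) (0, u) (0, v) (0, w) (0, t) = F x * covRiem G₂ y m u v w t := by
  have e : (fun y' => riem G (x, y') (0, u) (0, v) (0, w) (0, t)) =ᶠ[nhds y]
      fun y' => F x * riem G₂ y' u v w t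
        + fderiv ℝ F x (grad G₁ F x) / 8 * kn (G₂ y') (G₂ y') u v w t := by
    filter_upwards [h.fiber.mem_nhds hy] with y' hy' using h.riem_fiber hx hy' u v w t
  have d := h.fiber.differentiableAt_riem hy
  have g (a b : E₂) : HasFDerivAt (fun y' => G₂ y' a b) (fderiv ℝ (fun y' => G₂ y' a b) y) y := by
    have := h.fiber.differentiableAt hy
    exact (show DifferentiableAt ℝ (fun y' => G₂ y' a b) y by fun_prop).hasFDerivAt
  have k : HasFDerivAt (fun y' => kn (G₂ y') (G₂ y') u v w t) _ y :=
    ((((g u t).mul (g v w)).add ((g v w).mul (g u t))).sub ((g u w).mul (g v t))).sub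
      ((g v t).mul (g u w))
  rw [covRiem, fderiv_along_fiber (h.isMetricOn.differentiableAt_riem ⟨hx, hy⟩ _ _ _ _),
    e.fderiv_eq, (((d u v w t).hasFDerivAt.const_mul (F x)).fun_add
      (k.const_mul (fderiv ℝ F x (grad G₁ F x) / 8))).fderiv]
  simp only [add_apply, sub_apply, smul_apply, smul_eq_mul,
    ← fderiv_eval₂ (h.fiber.differentiableAt hy), h.fiber.fderiv_eq_christoffel hy,
    h.christoffel_eq hx hy, map_zero, zero_smul, add_zero, zero_apply, smul_zero, zero_sub,
    h.riem_eq hx hy, covRiem, kn]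
  rw [h.fiber.symm y hy u (christoffel G₂ y m t), h.fiber.symm y hy v (christoffel G₂ y m t),
    h.fiber.symm y hy u (christoffel G₂ y m w), h.fiber.symm y hy v (christoffel G₂ y m w)]
  simp [riem]
  ring

theorem covRiem_fiber_mixed (m : E₂) (u : E₁) (v : E₂) (w : E₁) (t : E₂) :
    covRiem G (x, y) (0, m) (u, 0) (0, v) (w, 0) (0, t) = 0 := by
  have e : (fun y' => riem G (x, y') (u, 0) (0, v) (w, 0) (0, t)) =ᶠ[nhds y]
      fun y' => F x * modelT G₁ F x u w * G₂ y' v t := by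
    filter_upwards [h.fiber.mem_nhds hy] with y' hy' using h.riem_mixed hx hy' u v w t
  have g : DifferentiableAt ℝ (fun y' => G₂ y' v t) y := by
    have := h.fiber.differentiableAt hy
    fun_prop
  rw [covRiem, fderiv_along_fiber (h.isMetricOn.differentiableAt_riem ⟨hx, hy⟩ _ _ _ _),
    e.fderiv_eq, (g.hasFDerivAt.const_mul (F x * modelT G₁ F x u w)).fderiv]
  simp only [smul_apply, smul_eq_mul,
    ← fderiv_eval₂ (h.fiber.differentiableAt hy), h.fiber.fderiv_eq_christoffel hy,
    h.christoffel_eq hx hy, h.riem_eq hx hy]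
  simp [kn, riem]
  rw [h.fiber.symm y hy v (christoffel G₂ y m t)]
  ring

/-- The differentiated component is identically zero, so only connection terms remain: $\nabla_m u$
is a multiple of $m$ and produces vertical curvature, while the horizontal parts of $\nabla_m
v,\nabla_m w,\nabla_m t$ are multiples of the gradient and produce $T(u,\mathrm{grad}f)$. -/
theorem covRiem_fiber_base_fiber (m : E₂) (u : E₁) (v w t : E₂) :
    covRiem G (x, y) (0, m) (u, 0) (0, v) (0, w) (0, t) =
      -(1 / 2 * fderiv ℝ F x u) * (riem G₂ y m v w t +
        fderiv ℝ F x (grad G₁ F x) / (8 * F x) * kn (G₂ y) (G₂ y) m v w t) -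
      1 / 4 * F x * modelT G₁ F x u (grad G₁ F x) * kn (G₂ y) (G₂ y) m v w t := by
  have hF := (h.pos x hx).ne'
  have e : (fun y' => riem G (x, y') (u, 0) (0, v) (0, w) (0, t)) =ᶠ[nhds y]
      fun y' => 0 := by
    filter_upwards [h.fiber.mem_nhds hy] with y' hy' using h.riem_base_fiber hx hy' u v w t
  rw [covRiem, fderiv_along_fiber (h.isMetricOn.differentiableAt_riem ⟨hx, hy⟩ _ _ _ _),
    e.fderiv_eq]
  simp only [h.christoffel_eq hx hy, h.riem_eq hx hy]
  simp [kn, riem]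
  field_simp
  ring

/-- Only proportionality to $\widetilde g$ matters later; the value of the factor is never used. -/
theorem exists_covRiem_base_mixed (m u w : E₁) : ∃ k : ℝ, ∀ v t : E₂,
    covRiem G (x, y) (m, 0) (u, 0) (0, v) (w, 0) (0, t) = k * G₂ y v t := by
  refine ⟨fderiv ℝ (fun x' => F x' * modelT G₁ F x' u w) x m -
    F x * modelT G₁ F x (christoffel G₁ x m u) w - F x * modelT G₁ F x u (christoffel G₁ x m w) -
    fderiv ℝ F x m * modelT G₁ F x u w, fun v t => ?_⟩
  have hF := (h.pos x hx).ne'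
  have e : (fun x' => riem G (x', y) (u, 0) (0, v) (w, 0) (0, t)) =ᶠ[nhds x]
      G₂ y v t • fun x' => F x' * modelT G₁ F x' u w := by
    filter_upwards [h.base.mem_nhds hx] with x' hx'
    rw [h.riem_mixed hx' hy u v w t, Pi.smul_apply, smul_eq_mul, mul_comm]
  rw [covRiem, fderiv_along_base (h.isMetricOn.differentiableAt_riem ⟨hx, hy⟩ _ _ _ _),
    e.fderiv_eq, fderiv_const_smul_field]
  simp only [h.christoffel_eq hx hy, h.riem_eq hx hy]
  simp [kn, riem]
  field_simp
  ring

theorem covRiem_base_fiber_of_fderiv_eq_zero (h0 : ∀ x ∈ U₁, fderiv ℝ F x = 0)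
    (m : E₁) (u v w t : E₂) :
    covRiem G (x, y) (m, 0) (0, u) (0, v) (0, w) (0, t) = 0 := by
  have e : (fun x' => riem G (x', y) (0, u) (0, v) (0, w) (0, t)) =ᶠ[nhds x]
      riem G₂ y u v w t • F := by
    filter_upwards [h.base.mem_nhds hx] with x' hx'
    rw [h.riem_fiber hx' hy, h0 x' hx', Pi.smul_apply, smul_eq_mul, mul_comm]
    simp
  rw [covRiem, fderiv_along_base (h.isMetricOn.differentiableAt_riem ⟨hx, hy⟩ _ _ _ _),
    e.fderiv_eq, fderiv_const_smul_field, Pi.smul_apply, h0 x hx]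
  simp only [h.christoffel_eq hx hy, h.riem_eq hx hy, h0 x hx]
  simp [kn, riem]

end IsWarpedOn

end WarpedCovariantDerivative

/-! ### Passage from a manifold to the chart at a point. -/

section Chart

variable {E : Type*} [NormedAddCommGroup E] [NormedSpace ℝ E]
  {H : Type*} [TopologicalSpace H] (I : ModelWithCorners ℝ E H) [I.Boundaryless]
  {M : Type*} [TopologicalSpace M] [ChartedSpace H M] [IsManifold I ∞ M]

theorem mdifferentiableAt_extChartAt_symm {z : M} {u : E} (hu : u ∈ (extChartAt I z).target) :
    MDifferentiableAt 𝓘(ℝ, E) I (extChartAt I z).symm u := by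
  have := mdifferentiableWithinAt_extChartAt_symm hu
  rwa [I.range_eq_univ, mdifferentiableWithinAt_univ] at this

theorem isInvertible_chartInvDeriv {z : M} {u : E} (hu : u ∈ (extChartAt I z).target) :
    (chartInvDeriv I z u).IsInvertible := by
  have := isInvertible_mfderivWithin_extChartAt_symm hu
  rw [I.range_eq_univ, mfderivWithin_univ] at this
  exact this

theorem chartInvDeriv_self (z : M) :
    chartInvDeriv I z (extChartAt I z z) = ContinuousLinearMap.id ℝ E := by
  have := mfderivWithin_range_extChartAt_symm (I := I) (x := z)
  rw [I.range_eq_univ, mfderivWithin_univ] at this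
  exact this

variable {I}

theorem chartBilin_self (g : BilinField I M) (z : M) :
    chartBilin g z (extChartAt I z z) = g z := by
  unfold chartBilin
  rw [chartInvDeriv_self, extChartAt_to_inv]
  rfl

theorem chartBilin_apply (g : BilinField I M) (z : M) (u a b : E) :
    chartBilin g z u a b =
      g ((extChartAt I z).symm u) (chartInvDeriv I z u a) (chartInvDeriv I z u b) := rfl

theorem IsSemiRiemannian.isMetricOn {g : BilinField I M} (hg : IsSemiRiemannian g) (z : M) :
    IsMetricOn (chartBilin g z) (extChartAt I z).target where
  isOpen := isOpen_extChartAt_target z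
  smooth := hg.smooth z
  symm := fun u _ a b => by
    rw [chartBilin_apply, chartBilin_apply]
    exact hg.symm _ _ _
  nondegenerate := fun u hu a ha => by
    have hinv := isInvertible_chartInvDeriv I hu
    have h0 : chartInvDeriv I z u a = 0 := by
      refine hg.nondegenerate ((extChartAt I z).symm u) _ fun b => ?_
      obtain ⟨c, rfl⟩ := hinv.surjective b
      rw [← chartBilin_apply]
      exact ha c
    exact hinv.injective (h0.trans (map_zero _).symm)

theorem fderiv_comp_chart {f : M → ℝ} (hf : ContMDiff I 𝓘(ℝ, ℝ) ∞ f) (z : M) :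
    fderiv ℝ (f ∘ (extChartAt I z).symm) (extChartAt I z z) = mfderiv I 𝓘(ℝ, ℝ) f z := by
  -- Naming the derivative gives it a type on `E` instead of the tangent space.
  obtain ⟨L, hL⟩ : ∃ L : E →L[ℝ] ℝ, L = mfderiv I 𝓘(ℝ, ℝ) f z := ⟨_, rfl⟩
  have : HasFDerivWithinAt (f ∘ (extChartAt I z).symm) L Set.univ (extChartAt I z z) := by
    rw [← I.range_eq_univ, hL]
    exact (hf.mdifferentiableAt (x := z) (by simp)).hasMFDerivAt.2
  rw [hasFDerivWithinAt_univ] at this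
  exact this.fderiv.trans hL

theorem contDiffOn_comp_chart {f : M → ℝ} (hf : ContMDiff I 𝓘(ℝ, ℝ) ∞ f) (z : M) :
    ContDiffOn ℝ ∞ (f ∘ (extChartAt I z).symm) (extChartAt I z).target := by
  rw [← contMDiffOn_iff_contDiffOn]
  exact hf.comp_contMDiffOn (contMDiffOn_extChartAt_symm z)

end Chart

/-! ### Product charts put the warped metric into model form. -/

section WarpedChart

variable {E₁ : Type*} [NormedAddCommGroup E₁] [NormedSpace ℝ E₁] [FiniteDimensional ℝ E₁]
  {H₁ : Type*} [TopologicalSpace H₁] {I₁ : ModelWithCorners ℝ E₁ H₁} [I₁.Boundaryless]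
  {B : Type*} [TopologicalSpace B] [ChartedSpace H₁ B] [IsManifold I₁ ∞ B]
  {E₂ : Type*} [NormedAddCommGroup E₂] [NormedSpace ℝ E₂] [FiniteDimensional ℝ E₂]
  {H₂ : Type*} [TopologicalSpace H₂] {I₂ : ModelWithCorners ℝ E₂ H₂} [I₂.Boundaryless]
  {F : Type*} [TopologicalSpace F] [ChartedSpace H₂ F] [IsManifold I₂ ∞ F]

theorem chartInvDeriv_prod {x : B} {y : F} {u : E₁} {v : E₂}
    (hu : u ∈ (extChartAt I₁ x).target) (hv : v ∈ (extChartAt I₂ y).target) :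
    chartInvDeriv (I₁.prod I₂) (x, y) (u, v) =
      (chartInvDeriv I₁ x u).prodMap (chartInvDeriv I₂ y v) := by
  have key := HasMFDerivAt.prodMap (p := (u, v))
    (mdifferentiableAt_extChartAt_symm I₁ hu).hasMFDerivAt
    (mdifferentiableAt_extChartAt_symm I₂ hv).hasMFDerivAt
  have key' : HasMFDerivAt 𝓘(ℝ, E₁ × E₂) (I₁.prod I₂) (extChartAt (I₁.prod I₂) (x, y)).symm (u, v)
      ((chartInvDeriv I₁ x u).prodMap (chartInvDeriv I₂ y v)) := by
    -- The product of the two vector space models and the model of `E₁ × E₂` differ only formally: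
    -- both ranges are everything, so the derivative statement carries over.
    rw [extChartAt_prod]
    refine ⟨key.1, ?_⟩
    have k2 := key.2
    rw [ModelWithCorners.range_eq_univ] at k2 ⊢
    exact k2
  exact key'.mfderiv

theorem isWarpedOn_chartBilin {gB : BilinField I₁ B} (hgB : IsSemiRiemannian gB)
    {gF : BilinField I₂ F} (hgF : IsSemiRiemannian gF) {f : B → ℝ}
    (hf : ContMDiff I₁ 𝓘(ℝ, ℝ) ∞ f) (hfpos : ∀ x, 0 < f x) (x : B) (y : F) :
    IsWarpedOn (chartBilin (warpedMetric gB f gF) (x, y)) (chartBilin gB x)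
      (f ∘ (extChartAt I₁ x).symm) (chartBilin gF y) (extChartAt I₁ x).target
      (extChartAt I₂ y).target where
  base := hgB.isMetricOn x
  fiber := hgF.isMetricOn y
  smooth := contDiffOn_comp_chart hf x
  pos := fun _ _ => hfpos _
  eq := fun u hu v hv a b => by
    unfold chartBilin
    rw [chartInvDeriv_prod hu hv]
    rfl

end WarpedChart

/-! ### Metric traces. -/

section Trace

variable {E : Type*} [NormedAddCommGroup E] [NormedSpace ℝ E] [FiniteDimensional ℝ E]

theorem metricTrace_smul (b h : E →L[ℝ] E →L[ℝ] ℝ) (c : ℝ) :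
    metricTrace b (c • h) = c * metricTrace b h := by
  rw [metricTrace, ContinuousLinearMap.comp_smul, map_smul, smul_eq_mul, metricTrace]

theorem metricTrace_self {b : E →L[ℝ] E →L[ℝ] ℝ} (hb : b.IsInvertible) :
    metricTrace b b = Module.finrank ℝ E := by
  rw [metricTrace, hb.inverse_comp_self]
  exact LinearMap.trace_id ℝ E

theorem metricTrace_smulRight (b : E →L[ℝ] E →L[ℝ] ℝ) (φ ψ : E →L[ℝ] ℝ) :
    metricTrace b (φ.smulRight ψ) = φ (b.inverse ψ) := by
  have e : ((b.inverse.comp (φ.smulRight ψ) : E →L[ℝ] E) : E →ₗ[ℝ] E) =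
      LinearMap.smulRight (φ : E →ₗ[ℝ] ℝ) (b.inverse ψ) := by
    ext u
    simp
  exact (congrArg (LinearMap.trace ℝ E) e).trans (LinearMap.trace_smulRight _ _)

end Trace

/-! ### Pointwise consequences of $(*)$ and of recurrence. -/

section WarpedRelations

variable {E₁ : Type*} [NormedAddCommGroup E₁] [NormedSpace ℝ E₁] [FiniteDimensional ℝ E₁]
  {E₂ : Type*} [NormedAddCommGroup E₂] [NormedSpace ℝ E₂] [FiniteDimensional ℝ E₂]

namespace IsWarpedOn

variable {G : E₁ × E₂ → E₁ × E₂ →L[ℝ] E₁ × E₂ →L[ℝ] ℝ}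
  {G₁ : E₁ → E₁ →L[ℝ] E₁ →L[ℝ] ℝ} {F : E₁ → ℝ} {G₂ : E₂ → E₂ →L[ℝ] E₂ →L[ℝ] ℝ}
  {U₁ : Set E₁} {U₂ : Set E₂} (h : IsWarpedOn G G₁ F G₂ U₁ U₂)
  {x : E₁} {y : E₂} (hx : x ∈ U₁) (hy : y ∈ U₂) {π φ : E₁ × E₂ →L[ℝ] ℝ}
include h hx hy

theorem base_relation (hD : ∀ m u v w t, covRiem G (x, y) m u v w t =
      π m * riem G (x, y) u v w t + φ m * kn (ric G (x, y)) (ric G (x, y)) u v w t)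
    {l : ℝ} (hl : modelT G₁ F x = l • ric G₁ x) (m u v w t : E₁) :
    covRiem G₁ x m u v w t = π (m, 0) * riem G₁ x u v w t +
      (1 - Module.finrank ℝ E₂ * l) ^ 2 * φ (m, 0) * kn (ric G₁ x) (ric G₁ x) u v w t := by
  rw [← h.covRiem_base hx hy, hD, h.riem_base hx hy]
  simp only [kn, h.ric_eq hx hy, hl, smul_apply, smul_eq_mul, map_zero]
  ring

theorem base_recurrent (hR : ∀ m u v w t, covRiem G (x, y) m u v w t =
      π m * riem G (x, y) u v w t) (m u v w t : E₁) :
    covRiem G₁ x m u v w t = π (m, 0) * riem G₁ x u v w t := by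
  rw [← h.covRiem_base hx hy, hR, h.riem_base hx hy]

theorem fiber_relation (hD : ∀ m u v w t, covRiem G (x, y) m u v w t =
      π m * riem G (x, y) u v w t + φ m * kn (ric G (x, y)) (ric G (x, y)) u v w t)
    {P Q : ℝ} (hP : P = fderiv ℝ F x (grad G₁ F x) / (4 * F x ^ 2))
    (hQ : Q = F x * (((Module.finrank ℝ E₂ : ℝ) - 1) * P - metricTrace (G₁ x) (modelT G₁ F x)))
    (m u v w t : E₂) :
    covRiem G₂ y m u v w t = π (0, m) * riem G₂ y u v w t +
      1 / F x * φ (0, m) * kn (ric G₂ y) (ric G₂ y) u v w t +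
      2 * Q / F x * φ (0, m) * kn (G₂ y) (ric G₂ y) u v w t +
      (1 / 2 * F x * P * π (0, m) + Q ^ 2 / F x * φ (0, m)) * kn (G₂ y) (G₂ y) u v w t := by
  have hF := (h.pos x hx).ne'
  have e := h.covRiem_fiber hx hy m u v w t
  rw [hD, h.riem_fiber hx hy] at e
  simp only [kn, h.ric_eq hx hy, map_zero, mul_zero, sub_zero, zero_add, ← hP, ← hQ]
    at e
  have hP' : fderiv ℝ F x (grad G₁ F x) = 4 * F x ^ 2 * P := by
    rw [hP]
    field_simp
  rw [hP'] at e
  refine mul_left_cancel₀ hF (e.symm.trans ?_)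
  simp only [kn]
  field_simp
  ring

/-- Apart from the tensors of the fiber, every factor here depends on `x` only; this is why the
curvature constant does not vary with `y`. -/
theorem curvature_of_covRiem_eq_zero {m v w t : E₂} {u : E₁}
    (h0 : covRiem G (x, y) (0, m) (u, 0) (0, v) (0, w) (0, t) = 0) :
    fderiv ℝ F x u * riem G₂ y m v w t =
      -(fderiv ℝ F x u * (fderiv ℝ F x (grad G₁ F x) / (8 * F x)) +
        1 / 2 * F x * modelT G₁ F x u (grad G₁ F x)) * kn (G₂ y) (G₂ y) m v w t := by
  rw [h.covRiem_fiber_base_fiber hx hy] at h0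
  linear_combination -2 * h0

/-- With exactly one horizontal argument, each product in $S\wedge S$ contains a mixed component of
$S$, hence vanishes, as does $R$. -/
theorem covRiem_eq_zero_of_relation (hD : ∀ m u v w t, covRiem G (x, y) m u v w t =
      π m * riem G (x, y) u v w t + φ m * kn (ric G (x, y)) (ric G (x, y)) u v w t)
    (m : E₂) (u : E₁) (v w t : E₂) :
    covRiem G (x, y) (0, m) (u, 0) (0, v) (0, w) (0, t) = 0 := by
  rw [hD, h.riem_base_fiber hx hy]
  simp [kn, h.ric_eq hx hy]

theorem covRiem_eq_zero_of_recurrent (hR : ∀ m u v w t, covRiem G (x, y) m u v w t =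
      π m * riem G (x, y) u v w t) (m : E₂) (u : E₁) (v w t : E₂) :
    covRiem G (x, y) (0, m) (u, 0) (0, v) (0, w) (0, t) = 0 := by
  rw [hR, h.riem_base_fiber hx hy, mul_zero]

/-- If the warped product is recurrent at a point, so is the fiber at its projection. -/
theorem fiber_recurrent (hR : ∀ m u v w t, covRiem G (x, y) m u v w t =
      π m * riem G (x, y) u v w t) :
    ∃ ξ : E₂ →L[ℝ] ℝ, ∀ m u v w t, covRiem G₂ y m u v w t = ξ m * riem G₂ y u v w t := by
  have hF := (h.pos x hx).ne'
  have key (m u v w t : E₂) : covRiem G₂ y m u v w t = π (0, m) * (riem G₂ y u v w t +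
      fderiv ℝ F x (grad G₁ F x) / (8 * F x) * kn (G₂ y) (G₂ y) u v w t) := by
    have e := h.covRiem_fiber hx hy m u v w t
    rw [hR, h.riem_fiber hx hy] at e
    refine mul_left_cancel₀ hF (e.symm.trans ?_)
    field_simp
  -- If $df=0$ the $\widetilde g\wedge\widetilde g$ term is absent. Otherwise $\xi=0$ works:
  -- wherever $\pi(0,m)\neq0$, the bracket in `key` vanishes.
  by_cases hdF : fderiv ℝ F x = 0
  · refine ⟨π.comp (ContinuousLinearMap.inr ℝ E₁ E₂), fun m u v w t => ?_⟩
    rw [key, hdF]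
    simp
  · refine ⟨0, fun m u v w t => ?_⟩
    rw [key, zero_apply, zero_mul]
    by_cases hm : π (0, m) = 0
    · rw [hm, zero_mul]
    · obtain ⟨a, ha⟩ : ∃ a, fderiv ℝ F x a ≠ 0 := by
        by_contra! hcon
        exact hdF (ContinuousLinearMap.ext hcon)
      have e1 := h.curvature_of_covRiem_eq_zero hx hy
        (h.covRiem_eq_zero_of_recurrent hx hy hR u a v w t)
      -- The mixed component of $\nabla R$ in a vertical direction is zero, so recurrence with
      -- $\pi(0,m)\neq0$ annihilates the mixed component $f\,T\otimes\widetilde g$ of $R$.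
      have e2 (v' t' : E₂) : modelT G₁ F x a (grad G₁ F x) * G₂ y v' t' = 0 := by
        have e3 := h.covRiem_fiber_mixed hx hy m a v' (grad G₁ F x) t'
        rw [hR, h.riem_mixed hx hy] at e3
        simpa [hm, hF] using e3
      have e4 : modelT G₁ F x a (grad G₁ F x) * kn (G₂ y) (G₂ y) u v w t = 0 := by
        rw [kn]
        linear_combination G₂ y v w * e2 u t + G₂ y u t * e2 v w - G₂ y v t * e2 u w -
          G₂ y u w * e2 v t
      refine mul_eq_zero_of_right _ (mul_left_cancel₀ ha ?_)
      linear_combination e1 - 1 / 2 * F x * e4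

/-- The nonzero trace provides $a,b$ with $s=(\overline S-qT)(a,b)\neq0$. The component of $(*)$ on
$(a,v,b,t)$ then reads $k\widetilde g=\pi(m)fT(a,b)\widetilde g-2\varphi(m)s(\widetilde
S+Q\widetilde g)$, which is solved for $\widetilde S$. -/
theorem exists_ric_fiber_eq (hD : ∀ m u v w t, covRiem G (x, y) m u v w t =
      π m * riem G (x, y) u v w t + φ m * kn (ric G (x, y)) (ric G (x, y)) u v w t)
    (hS : metricTrace (G₁ x) (ric G₁ x) -
      Module.finrank ℝ E₂ * metricTrace (G₁ x) (modelT G₁ F x) ≠ 0) (hφ : φ ≠ 0) :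
    ∃ μ : ℝ, ric G₂ y = μ • G₂ y := by
  obtain ⟨a, b, hab⟩ : ∃ a b, ric G₁ x a b - Module.finrank ℝ E₂ * modelT G₁ F x a b ≠ 0 := by
    by_contra! hcon
    apply hS
    have : ric G₁ x = (Module.finrank ℝ E₂ : ℝ) • modelT G₁ F x := by
      ext a b
      exact sub_eq_zero.1 (hcon a b)
    rw [this, metricTrace_smul, sub_self]
  obtain ⟨m, hm, k, hk⟩ : ∃ m, φ m ≠ 0 ∧ ∃ k : ℝ, ∀ v t : E₂,
      covRiem G (x, y) m (a, 0) (0, v) (b, 0) (0, t) = k * G₂ y v t := by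
    -- A direction with $\varphi(m)\neq0$ can be taken purely horizontal or purely vertical, the two
    -- cases in which the component of $\nabla R$ is known.
    by_cases h1 : ∃ m₁, φ (m₁, 0) ≠ 0
    · obtain ⟨m₁, h1⟩ := h1
      exact ⟨(m₁, 0), h1, h.exists_covRiem_base_mixed hx hy m₁ a b⟩
    · by_cases h2 : ∃ m₂, φ (0, m₂) ≠ 0
      · obtain ⟨m₂, h2⟩ := h2
        refine ⟨(0, m₂), h2, 0, fun v t => ?_⟩
        rw [h.covRiem_fiber_mixed hx hy, zero_mul]
      · push Not at h1 h2
        refine absurd (ContinuousLinearMap.ext fun m => ?_) hφ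
        have : m = (m.1, 0) + (0, m.2) := by simp
        rw [this, map_add, h1, h2]
        simp
  set s := ric G₁ x a b - Module.finrank ℝ E₂ * modelT G₁ F x a b with hs
  set Q := F x * (((Module.finrank ℝ E₂ : ℝ) - 1) *
    (fderiv ℝ F x (grad G₁ F x) / (4 * F x ^ 2)) - metricTrace (G₁ x) (modelT G₁ F x)) with hQ
  refine ⟨(π m * F x * modelT G₁ F x a b - k) / (2 * φ m * s) - Q, ?_⟩
  ext v t
  have e := hk v t
  rw [hD, h.riem_mixed hx hy] at e
  simp only [kn, h.ric_eq hx hy, map_zero, zero_apply, mul_zero, sub_zero, zero_add, add_zero,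
    ← hs, ← hQ] at e
  simp only [smul_apply, smul_eq_mul]
  field_simp
  linear_combination -e

theorem fiber_relation_of_fderiv_eq_zero
    (hD : ∀ m u v w t, covRiem G (x, y) m u v w t =
      π m * riem G (x, y) u v w t + φ m * kn (ric G (x, y)) (ric G (x, y)) u v w t)
    (h0 : ∀ x ∈ U₁, fderiv ℝ F x = 0) (m : E₁) (u v w t : E₂) :
    F x * π (m, 0) * riem G₂ y u v w t + φ (m, 0) * kn (ric G₂ y) (ric G₂ y) u v w t = 0 := by
  have hT : modelT G₁ F x = 0 := by
    have h1 : fderiv ℝ (fderiv ℝ F) x = 0 := by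
      have e : fderiv ℝ F =ᶠ[nhds x] fun _ => 0 := by
        filter_upwards [h.base.mem_nhds hx] with x' hx' using h0 x' hx'
      rw [e.fderiv_eq]
      simp
    ext a b
    rw [modelT_apply, h0 x hx, h1]
    simp
  have e := h.covRiem_base_fiber_of_fderiv_eq_zero hx hy h0 m u v w t
  rw [hD, h.riem_fiber hx hy] at e
  have hT0 : metricTrace (G₁ x) 0 = 0 := by simp [metricTrace]
  simp only [kn, h.ric_eq hx hy, map_zero, zero_apply, mul_zero, sub_zero, zero_add, h0 x hx,
    zero_div, zero_mul, add_zero, hT, hT0] at e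
  rw [kn]
  linear_combination e

end IsWarpedOn

end WarpedRelations

/-! ### Smooth 1-forms. -/

section Forms

variable {E : Type*} [NormedAddCommGroup E] [NormedSpace ℝ E]
  {H : Type*} [TopologicalSpace H] {I : ModelWithCorners ℝ E H} [I.Boundaryless]
  {M : Type*} [TopologicalSpace M] [ChartedSpace H M] [IsManifold I ∞ M]

theorem IsSmoothForm.add {α β : CovectorField I M} (hα : IsSmoothForm α) (hβ : IsSmoothForm β) :
    IsSmoothForm (α + β) := fun z => (hα z).add (hβ z)

theorem IsSmoothForm.smul {α : CovectorField I M} (hα : IsSmoothForm α) {c : M → ℝ}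
    (hc : ContMDiff I 𝓘(ℝ, ℝ) ∞ c) : IsSmoothForm (fun z => c z • α z) := fun z =>
  (contDiffOn_comp_chart hc z).smul (hα z)

theorem IsSmoothForm.const_smul {α : CovectorField I M} (hα : IsSmoothForm α) (c : ℝ) :
    IsSmoothForm (c • α) := hα.smul contMDiff_const

theorem chartCovector_apply (α : CovectorField I M) (z : M) (u a : E) :
    chartCovector α z u a = α ((extChartAt I z).symm u) (chartInvDeriv I z u a) := rfl

end Forms

/-! ### Slices of 1-forms, and assertions (i), (ii) and (iv) on the manifold. -/

section WarpedManifold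

variable {E₁ : Type*} [NormedAddCommGroup E₁] [NormedSpace ℝ E₁] [FiniteDimensional ℝ E₁]
  {H₁ : Type*} [TopologicalSpace H₁] {I₁ : ModelWithCorners ℝ E₁ H₁} [I₁.Boundaryless]
  {B : Type*} [TopologicalSpace B] [ChartedSpace H₁ B] [IsManifold I₁ ∞ B]
  {E₂ : Type*} [NormedAddCommGroup E₂] [NormedSpace ℝ E₂] [FiniteDimensional ℝ E₂]
  {H₂ : Type*} [TopologicalSpace H₂] {I₂ : ModelWithCorners ℝ E₂ H₂} [I₂.Boundaryless]
  {F : Type*} [TopologicalSpace F] [ChartedSpace H₂ F] [IsManifold I₂ ∞ F]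

theorem chartCovector_prod_apply (α : CovectorField (I₁.prod I₂) (B × F)) {x x' : B} {y y' : F}
    (hx : x' ∈ (extChartAt I₁ x).source) (hy : y' ∈ (extChartAt I₂ y).source) (a : E₁) (b : E₂) :
    chartCovector α (x, y) (extChartAt I₁ x x', extChartAt I₂ y y') (a, b) =
      α (x', y') (chartInvDeriv I₁ x (extChartAt I₁ x x') a,
        chartInvDeriv I₂ y (extChartAt I₂ y y') b) := by
  rw [chartCovector_apply, chartInvDeriv_prod ((extChartAt I₁ x).map_source hx)
    ((extChartAt I₂ y).map_source hy)]
  have e : (extChartAt (I₁.prod I₂) (x, y)).symm (extChartAt I₁ x x', extChartAt I₂ y y') =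
      (x', y') :=
    Prod.ext ((extChartAt I₁ x).left_inv hx) ((extChartAt I₂ y).left_inv hy)
  -- A covector field is a dependent function, so `e` cannot be rewritten directly; all tangent
  -- spaces are the model space, which makes the transport trivial.
  have key (p q : B × F) (hpq : p = q) (v : E₁ × E₂) : α p v = α q v := by subst hpq; rfl
  exact key _ _ e _

theorem IsSmoothForm.basePart {α : CovectorField (I₁.prod I₂) (B × F)} (hα : IsSmoothForm α)
    (y : F) : IsSmoothForm (basePart α y) := fun x => by
  have h1 : ContDiffOn ℝ ∞ (fun u => (chartCovector α (x, y) (u, extChartAt I₂ y y)).comp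
      (ContinuousLinearMap.inl ℝ E₁ E₂)) (extChartAt I₁ x).target := by
    refine ContDiffOn.clm_comp ?_ contDiffOn_const
    refine (hα (x, y)).comp (contDiffOn_id.prodMk contDiffOn_const) fun u hu => ?_
    rw [extChartAt_prod]
    exact ⟨hu, mem_extChartAt_target y⟩
  refine h1.congr fun u hu => ContinuousLinearMap.ext fun a => ?_
  have e := chartCovector_prod_apply α ((extChartAt I₁ x).map_target hu)
    (mem_extChartAt_source (I := I₂) y) a 0
  rw [(extChartAt I₁ x).right_inv hu, map_zero] at e
  exact e.symm

theorem IsSmoothForm.fiberPart {α : CovectorField (I₁.prod I₂) (B × F)} (hα : IsSmoothForm α)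
    (x : B) : IsSmoothForm (fiberPart α x) := fun y => by
  have h1 : ContDiffOn ℝ ∞ (fun v => (chartCovector α (x, y) (extChartAt I₁ x x, v)).comp
      (ContinuousLinearMap.inr ℝ E₁ E₂)) (extChartAt I₂ y).target := by
    refine ContDiffOn.clm_comp ?_ contDiffOn_const
    refine (hα (x, y)).comp (contDiffOn_const.prodMk contDiffOn_id) fun u hu => ?_
    rw [extChartAt_prod]
    exact ⟨mem_extChartAt_target x, hu⟩
  refine h1.congr fun u hu => ContinuousLinearMap.ext fun a => ?_
  have e := chartCovector_prod_apply α (mem_extChartAt_source (I := I₁) x)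
    ((extChartAt I₂ y).map_target hu) 0 a
  rw [(extChartAt I₂ y).right_inv hu, map_zero] at e
  exact e.symm

variable {gB : BilinField I₁ B} {gF : BilinField I₂ F} {f : B → ℝ}

theorem warpT_eq (hf : ContMDiff I₁ 𝓘(ℝ, ℝ) ∞ f) (x : B) :
    warpT gB f x =
      modelT (chartBilin gB x) (f ∘ (extChartAt I₁ x).symm) (extChartAt I₁ x x) := by
  have e : (differential (I₁ := I₁) f x : E₁ →L[ℝ] ℝ) =
      fderiv ℝ (f ∘ (extChartAt I₁ x).symm) (extChartAt I₁ x x) := (fderiv_comp_chart hf x).symm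
  have e' : (f ∘ (extChartAt I₁ x).symm) (extChartAt I₁ x x) = f x := by
    rw [Function.comp_apply, extChartAt_to_inv]
  unfold warpT modelT
  rw [e', ← e]

theorem warpP_eq (hf : ContMDiff I₁ 𝓘(ℝ, ℝ) ∞ f) (x : B) :
    warpP gB f x = fderiv ℝ (f ∘ (extChartAt I₁ x).symm) (extChartAt I₁ x x)
      (grad (chartBilin gB x) (f ∘ (extChartAt I₁ x).symm) (extChartAt I₁ x x)) /
        (4 * (f ∘ (extChartAt I₁ x).symm) (extChartAt I₁ x x) ^ 2) := by
  have e : (differential (I₁ := I₁) f x : E₁ →L[ℝ] ℝ) =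
      fderiv ℝ (f ∘ (extChartAt I₁ x).symm) (extChartAt I₁ x x) := (fderiv_comp_chart hf x).symm
  have e' : (f ∘ (extChartAt I₁ x).symm) (extChartAt I₁ x x) = f x := by
    rw [Function.comp_apply, extChartAt_to_inv]
  have e'' := metricTrace_smulRight (chartBilin gB x (extChartAt I₁ x x))
    (fderiv ℝ (f ∘ (extChartAt I₁ x).symm) (extChartAt I₁ x x))
    (fderiv ℝ (f ∘ (extChartAt I₁ x).symm) (extChartAt I₁ x x))
  rw [e', grad, ← e'', chartBilin_self, ← e]
  exact one_div_mul_eq_div _ _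

variable (hgB : IsSemiRiemannian gB) (hgF : IsSemiRiemannian gF)
  (hf : ContMDiff I₁ 𝓘(ℝ, ℝ) ∞ f) (hfpos : ∀ x, 0 < f x)
  {Pi Phi : CovectorField (I₁.prod I₂) (B × F)}
include hgB hgF hf hfpos

/-- A non-constant warping function forces the fiber to have constant curvature. -/
theorem exists_constant_curvature (hM : IsWGK (warpedMetric gB f gF) Pi Phi) {x : B}
    (hx : differential (I₁ := I₁) f x ≠ 0) :
    ∃ c : ℝ, ∀ (y : F) (u v w t : TangentSpace I₂ y),
      curvature gF y u v w t = c * knAt (gF y) (gF y) u v w t := by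
  have e : (differential (I₁ := I₁) f x : E₁ →L[ℝ] ℝ) =
      fderiv ℝ (f ∘ (extChartAt I₁ x).symm) (extChartAt I₁ x x) := (fderiv_comp_chart hf x).symm
  obtain ⟨a, ha⟩ : ∃ a, fderiv ℝ (f ∘ (extChartAt I₁ x).symm) (extChartAt I₁ x x) a ≠ 0 := by
    by_contra! hcon
    exact hx (e.trans (ContinuousLinearMap.ext hcon))
  set φ := f ∘ (extChartAt I₁ x).symm with hφ
  set p := extChartAt I₁ x x with hp
  set K := grad (chartBilin gB x) φ p with hK
  refine ⟨-(fderiv ℝ φ p a * (fderiv ℝ φ p K / (8 * φ p)) +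
    1 / 2 * φ p * modelT (chartBilin gB x) φ p a K) / fderiv ℝ φ p a, fun y u v w t => ?_⟩
  have h := isWarpedOn_chartBilin hgB hgF hf hfpos x y
  have h0 : covRiem (chartBilin (warpedMetric gB f gF) (x, y))
      (p, extChartAt I₂ y y) (0, u) (a, 0) (0, v) (0, w) (0, t) = 0 := by
    -- A point where $(*)$ fails lies outside $U_g$, so recurrence holds there and kills the same
    -- component.
    by_cases hD : (x, y) ∈ wgkSet (warpedMetric gB f gF) Pi Phi
    · exact h.covRiem_eq_zero_of_relation (mem_extChartAt_target x) (mem_extChartAt_target y)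
        hD u a v w t
    · obtain ⟨ξ, hξ⟩ := not_not.1 fun hn => hD (hM.subset hn)
      exact h.covRiem_eq_zero_of_recurrent (mem_extChartAt_target x) (mem_extChartAt_target y)
        hξ u a v w t
  have k := h.curvature_of_covRiem_eq_zero (mem_extChartAt_target x) (mem_extChartAt_target y) h0
  rw [mul_comm, ← eq_div_iff ha, mul_div_right_comm, chartBilin_self] at k
  exact k

theorem exists_base_wgk [Nonempty F] (hM : IsWGK (warpedMetric gB f gF) Pi Phi) {l : B → ℝ}
    (hl : ContMDiff I₁ 𝓘(ℝ, ℝ) ∞ l) (hT : ∀ x, warpT gB f x = l x • ricci gB x) :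
    ∃ Pi' Phi' : CovectorField I₁ B, IsWGK gB Pi' Phi' ∧
      {x | ∀ y, (x, y) ∈ wgkSet (warpedMetric gB f gF) Pi Phi} ⊆ wgkSet gB Pi' Phi' := by
  -- Any one slice serves: the 1-forms on the base are restrictions to it.
  obtain ⟨y⟩ := ‹Nonempty F›
  have key (x : B) (hD : (x, y) ∈ wgkSet (warpedMetric gB f gF) Pi Phi) :
      x ∈ wgkSet gB (basePart Pi y)
        (fun x => (1 - Module.finrank ℝ E₂ * l x) ^ 2 • basePart Phi y x) := by
    intro m u v w t
    exact (isWarpedOn_chartBilin hgB hgF hf hfpos x y).base_relation (mem_extChartAt_target x)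
      (mem_extChartAt_target y) hD ((warpT_eq hf x).symm.trans (hT x)) m u v w t
  refine ⟨basePart Pi y, fun x => (1 - Module.finrank ℝ E₂ * l x) ^ 2 • basePart Phi y x,
    ⟨hM.smooth_Pi.basePart y, (hM.smooth_Phi.basePart y).smul ?_, fun x hx => key x ?_⟩,
    fun x hx => key x (hx y)⟩
  · exact (contMDiff_const.sub (contMDiff_const.mul hl)).pow 2
  -- Contrapositive: if $M$ is recurrent at $(x,y)$, the base is recurrent at $x$ with the
  -- horizontal part of $\xi$.
  · refine hM.subset fun ⟨ξ, hξ⟩ => hx ?_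
    refine ⟨ContinuousLinearMap.comp (M₂ := E₁ × E₂) ξ (ContinuousLinearMap.inl ℝ E₁ E₂),
      fun m u v w t => ?_⟩
    exact (isWarpedOn_chartBilin hgB hgF hf hfpos x y).base_recurrent (mem_extChartAt_target x)
      (mem_extChartAt_target y) hξ m u v w t

theorem fiber_sgk (hM : IsWGK (warpedMetric gB f gF) Pi Phi) (x : B) {P Q : ℝ}
    (hP : P = warpP gB f x) (hQ : Q = warpQ (Module.finrank ℝ E₂) gB f x) :
    IsSGK gF (fiberPart Pi x) ((1 / f x) • fiberPart Phi x) ((2 * Q / f x) • fiberPart Phi x)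
        ((1 / 2 * f x * P) • fiberPart Pi x + (Q ^ 2 / f x) • fiberPart Phi x) ∧
      {y | (x, y) ∈ wgkSet (warpedMetric gB f gF) Pi Phi} ⊆
        sgkSet gF (fiberPart Pi x) ((1 / f x) • fiberPart Phi x) ((2 * Q / f x) • fiberPart Phi x)
          ((1 / 2 * f x * P) • fiberPart Pi x + (Q ^ 2 / f x) • fiberPart Phi x) := by
  have e' : (f ∘ (extChartAt I₁ x).symm) (extChartAt I₁ x x) = f x := by
    rw [Function.comp_apply, extChartAt_to_inv]
  have key (y : F) (hD : (x, y) ∈ wgkSet (warpedMetric gB f gF) Pi Phi) :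
      y ∈ sgkSet gF (fiberPart Pi x) ((1 / f x) • fiberPart Phi x)
        ((2 * Q / f x) • fiberPart Phi x)
        ((1 / 2 * f x * P) • fiberPart Pi x + (Q ^ 2 / f x) • fiberPart Phi x) := by
    intro m u v w t
    have hQ' : Q = (f ∘ (extChartAt I₁ x).symm) (extChartAt I₁ x x) *
        (((Module.finrank ℝ E₂ : ℝ) - 1) * P -
          metricTrace (chartBilin gB x (extChartAt I₁ x x)) (modelT (chartBilin gB x)
            (f ∘ (extChartAt I₁ x).symm) (extChartAt I₁ x x))) := by
      rw [hQ, e', hP, chartBilin_self, ← warpT_eq hf]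
      rfl
    have k := (isWarpedOn_chartBilin hgB hgF hf hfpos x y).fiber_relation
      (mem_extChartAt_target x) (mem_extChartAt_target y) hD (hP.trans (warpP_eq hf x)) hQ' m u v w t
    rw [e', chartBilin_self] at k
    exact k
  have sPi := hM.smooth_Pi.fiberPart x
  have sPhi := hM.smooth_Phi.fiberPart x
  refine ⟨⟨sPi, sPhi.const_smul _, sPhi.const_smul _, (sPi.const_smul _).add (sPhi.const_smul _),
    fun y hy => key y (hM.subset fun ⟨ξ, hξ⟩ => hy ?_)⟩, key⟩
  exact (isWarpedOn_chartBilin hgB hgF hf hfpos x y).fiber_recurrent (mem_extChartAt_target x)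
    (mem_extChartAt_target y) hξ

theorem fiber_einstein {z : B × F} (hD : z ∈ wgkSet (warpedMetric gB f gF) Pi Phi)
    (hz : (scal gB z.1 - (Module.finrank ℝ E₂ : ℝ) * trace gB z.1 (warpT gB f z.1)) •
      Phi z ≠ 0) :
    ricci gF z.2 = (scal gF z.2 / (Module.finrank ℝ E₂ : ℝ)) • gF z.2 := by
  obtain ⟨x, y⟩ := z
  obtain ⟨hz1, hz2⟩ := smul_ne_zero_iff.1 hz
  have hinv : (chartBilin gF y (extChartAt I₂ y y)).IsInvertible :=
    (hgF.isMetricOn y).isInvertible (mem_extChartAt_target y)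
  obtain ⟨μ, hμ⟩ := (isWarpedOn_chartBilin hgB hgF hf hfpos x y).exists_ric_fiber_eq
    (mem_extChartAt_target x) (mem_extChartAt_target y) hD (by
      rw [chartBilin_self, ← warpT_eq hf]
      exact hz1) hz2
  -- For $q=0$ the quotient is a division by zero, but both tensors live on a trivial space. For
  -- $q>0$, tracing $\widetilde S=\mu\widetilde g$ gives $\mu=\widetilde\kappa/q$.
  rcases Nat.eq_zero_or_pos (Module.finrank ℝ E₂) with hq | hq
  · have : Subsingleton E₂ := Module.finrank_zero_iff.1 hq
    refine ContinuousLinearMap.ext fun u => ?_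
    have hu : u = 0 := Subsingleton.elim (α := E₂) u 0
    rw [hu, map_zero, map_zero]
  · have hs : scal gF y = μ * Module.finrank ℝ E₂ := by
      rw [← metricTrace_self hinv, ← metricTrace_smul, ← hμ, chartBilin_self]
      rfl
    rw [hs, mul_div_cancel_right₀ _ (by positivity)]
    rw [chartBilin_self] at hμ
    exact hμ

end WarpedManifold

/-! ### The Roter type condition for a warping function with vanishing differential. -/

section Roter

variable {E₁ : Type*} [NormedAddCommGroup E₁] [NormedSpace ℝ E₁] [FiniteDimensional ℝ E₁]
  {H₁ : Type*} [TopologicalSpace H₁] {I₁ : ModelWithCorners ℝ E₁ H₁} [I₁.Boundaryless]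
  {B : Type*} [TopologicalSpace B] [ChartedSpace H₁ B] [IsManifold I₁ ∞ B]
  {E₂ : Type*} [NormedAddCommGroup E₂] [NormedSpace ℝ E₂] [FiniteDimensional ℝ E₂]
  {H₂ : Type*} [TopologicalSpace H₂] {I₂ : ModelWithCorners ℝ E₂ H₂} [I₂.Boundaryless]
  {F : Type*} [TopologicalSpace F] [ChartedSpace H₂ F] [IsManifold I₂ ∞ F]

theorem IsSmoothForm.contMDiffOn_apply {α : CovectorField (I₁.prod I₂) (B × F)}
    (hα : IsSmoothForm α) (z₀ : B × F) (a : E₁ × E₂) :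
    ContMDiffOn (I₁.prod I₂) 𝓘(ℝ, ℝ) ∞
      (fun z => chartCovector α z₀ (extChartAt (I₁.prod I₂) z₀ z) a)
      (chartAt (ModelProd H₁ H₂) z₀).source := by
  have h1 : ContMDiffOn 𝓘(ℝ, E₁ × E₂) 𝓘(ℝ, ℝ) ∞ (fun u => chartCovector α z₀ u a)
      (extChartAt (I₁.prod I₂) z₀).target :=
    ((hα z₀).clm_apply contDiffOn_const).contMDiffOn
  refine h1.comp (contMDiffOn_extChartAt (I := I₁.prod I₂)) fun z hz => ?_
  exact (extChartAt (I₁.prod I₂) z₀).map_source (by rwa [extChartAt_source])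

variable {gB : BilinField I₁ B} {gF : BilinField I₂ F} {f : B → ℝ}

theorem fiber_relation_of_differential_eq_zero
    (hgB : IsSemiRiemannian gB) (hgF : IsSemiRiemannian gF)
    (hf : ContMDiff I₁ 𝓘(ℝ, ℝ) ∞ f) (hfpos : ∀ x, 0 < f x)
    {Pi Phi : CovectorField (I₁.prod I₂) (B × F)} (h0 : ∀ x, differential (I₁ := I₁) f x = 0)
    {z : B × F} (hD : z ∈ wgkSet (warpedMetric gB f gF) Pi Phi) (m : E₁)
    (u v w t : TangentSpace I₂ z.2) :
    f z.1 * basePart Pi z.2 z.1 m * curvature gF z.2 u v w t +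
      basePart Phi z.2 z.1 m * knAt (ricci gF z.2) (ricci gF z.2) u v w t = 0 := by
  obtain ⟨x, y⟩ := z
  have e' : (f ∘ (extChartAt I₁ x).symm) (extChartAt I₁ x x) = f x := by
    rw [Function.comp_apply, extChartAt_to_inv]
  -- Vanishing is needed on the whole chart domain, because the Hessian and $\nabla R$ involve
  -- further derivatives.
  have hd : ∀ p ∈ (extChartAt I₁ x).target, fderiv ℝ (f ∘ (extChartAt I₁ x).symm) p = 0 := by
    intro p hp
    have k : HasMFDerivAt I₁ 𝓘(ℝ, ℝ) f ((extChartAt I₁ x).symm p) 0 := by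
      have := (hf.mdifferentiableAt (x := (extChartAt I₁ x).symm p) (by simp)).hasMFDerivAt
      rwa [show mfderiv I₁ 𝓘(ℝ, ℝ) f ((extChartAt I₁ x).symm p) = 0 from h0 _] at this
    have k' := HasMFDerivAt.comp p k (mdifferentiableAt_extChartAt_symm I₁ hp).hasMFDerivAt
    have e : ContinuousLinearMap.comp (M₂ := E₁) (0 : E₁ →L[ℝ] ℝ)
        (chartInvDeriv I₁ x p) = 0 := ContinuousLinearMap.zero_comp _
    have k'' : HasMFDerivAt 𝓘(ℝ, E₁) 𝓘(ℝ, ℝ) (f ∘ (extChartAt I₁ x).symm) p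
        (0 : E₁ →L[ℝ] ℝ) := by
      rw [← e]
      exact k'
    have k3 : HasFDerivAt (f ∘ (extChartAt I₁ x).symm) (0 : E₁ →L[ℝ] ℝ) p :=
      hasMFDerivAt_iff_hasFDerivAt.1 k''
    exact k3.fderiv
  have k := (isWarpedOn_chartBilin hgB hgF hf hfpos x y).fiber_relation_of_fderiv_eq_zero
    (mem_extChartAt_target x) (mem_extChartAt_target y) hD hd m u v w t
  rw [e'] at k
  exact k

/-- If the warping function is locally constant, the fiber is of Roter type wherever the base part of
`Pi` does not vanish; the local solutions are glued by a partition of unity. -/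
theorem exists_roter [T2Space B] [SecondCountableTopology B] [T2Space F]
    [SecondCountableTopology F]
    (hgB : IsSemiRiemannian gB) (hgF : IsSemiRiemannian gF)
    (hf : ContMDiff I₁ 𝓘(ℝ, ℝ) ∞ f) (hfpos : ∀ x, 0 < f x)
    {Pi Phi : CovectorField (I₁.prod I₂) (B × F)} (hM : IsWGK (warpedMetric gB f gF) Pi Phi)
    (h0 : ∀ x, differential (I₁ := I₁) f x = 0) :
    ∃ N : B × F → ℝ, ContMDiffOn (I₁.prod I₂) 𝓘(ℝ, ℝ) ∞ N {z | basePart Pi z.2 z.1 ≠ 0} ∧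
      ∀ z ∈ {z : B × F | basePart Pi z.2 z.1 ≠ 0} ∩ wgkSet (warpedMetric gB f gF) Pi Phi,
        ∀ u v w t, curvature gF z.2 u v w t =
          -(N z * knAt (ricci gF z.2) (ricci gF z.2) u v w t) := by
  have : LocallyCompactSpace B := Manifold.locallyCompact_of_finiteDimensional I₁
  have : LocallyCompactSpace F := Manifold.locallyCompact_of_finiteDimensional I₂
  -- Homogeneous coefficients $p_1\widetilde R+p_2\,\widetilde S\wedge\widetilde S=0$ form a convex
  -- condition, and positivity of $p_1$ survives gluing; the quotient is taken only at the end.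
  -- Imposing each condition only where it is meaningful lets the gluing run over all of $M$.
  let A : B × F → Set (ℝ × ℝ) := fun z => {p | (basePart Pi z.2 z.1 ≠ 0 → 0 < p.1) ∧
    (z ∈ wgkSet (warpedMetric gB f gF) Pi Phi → ∀ u v w t,
      p.1 * curvature gF z.2 u v w t +
        p.2 * knAt (ricci gF z.2) (ricci gF z.2) u v w t = 0)}
  have hconv (z : B × F) : Convex ℝ (A z) := by
    intro p hp q hq a b ha hb hab
    refine ⟨fun hz => ?_, fun hz u v w t => ?_⟩
    · have h1 := hp.1 hz
      have h2 := hq.1 hz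
      rcases ha.eq_or_lt with rfl | ha
      · have : b = 1 := by linarith
        simpa [this] using h2
      · have : 0 < a * p.1 + b * q.1 := by positivity
        simpa using this
    · have h1 := hp.2 hz u v w t
      have h2 := hq.2 hz u v w t
      simp only [Prod.fst_add, Prod.smul_fst, smul_eq_mul, Prod.snd_add, Prod.smul_snd]
      linear_combination a * h1 + b * h2
  have hloc (z₀ : B × F) : ∃ U ∈ nhds z₀, ∃ g : B × F → ℝ × ℝ,
      ContMDiffOn (I₁.prod I₂) 𝓘(ℝ, ℝ × ℝ) ∞ g U ∧ ∀ z ∈ U, g z ∈ A z := by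
    let b := Module.finBasis ℝ E₁
    let c (α : CovectorField (I₁.prod I₂) (B × F)) (z : B × F) (i) : ℝ :=
      chartCovector α z₀ (extChartAt (I₁.prod I₂) z₀ z) (b i, 0)
    -- In horizontal components, multiplying $f\Pi_i\widetilde R+\Phi_i\widetilde S\wedge\widetilde
    -- S=0$ by $\Pi_i/f$ and summing gives the coefficients $\sum\Pi_i^2$ and
    -- $f^{-1}\sum\Pi_i\Phi_i$. The first is positive exactly where $\overline\Pi\neq0$, whatever
    -- the signature of the metric.
    refine ⟨(chartAt (ModelProd H₁ H₂) z₀).source, (chartAt (ModelProd H₁ H₂) z₀).open_source.mem_nhds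
      (mem_chart_source _ z₀), fun z => (∑ i, c Pi z i * c Pi z i,
      ∑ i, (f z.1)⁻¹ * (c Pi z i * c Phi z i)), ?_, fun z hz => ?_⟩
    · have hc {α : CovectorField (I₁.prod I₂) (B × F)} (hα : IsSmoothForm α) (i) :
          ContMDiffOn (I₁.prod I₂) 𝓘(ℝ, ℝ) ∞ (fun z => c α z i)
            (chartAt (ModelProd H₁ H₂) z₀).source := hα.contMDiffOn_apply z₀ (b i, 0)
      have hfi : ContMDiffOn (I₁.prod I₂) 𝓘(ℝ, ℝ) ∞ (fun z : B × F => (f z.1)⁻¹)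
          (chartAt (ModelProd H₁ H₂) z₀).source :=
        ((hf.comp contMDiff_fst).inv₀ fun z => (hfpos z.1).ne').contMDiffOn
      refine ContMDiffOn.prodMk_space ?_ ?_
      · exact contMDiffOn_finsetSum fun i _ => (hc hM.smooth_Pi i).mul (hc hM.smooth_Pi i)
      · exact contMDiffOn_finsetSum fun i _ =>
          hfi.mul ((hc hM.smooth_Pi i).mul (hc hM.smooth_Phi i))
    · obtain ⟨x, y⟩ := z
      have hx : x ∈ (extChartAt I₁ z₀.1).source := by
        rw [extChartAt_source]
        exact hz.1
      have hy : y ∈ (extChartAt I₂ z₀.2).source := by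
        rw [extChartAt_source]
        exact hz.2
      have hinv := isInvertible_chartInvDeriv I₁ ((extChartAt I₁ z₀.1).map_source hx)
      have hc (α : CovectorField (I₁.prod I₂) (B × F)) (i) : c α (x, y) i =
          basePart α y x (chartInvDeriv I₁ z₀.1 (extChartAt I₁ z₀.1 x) (b i)) := by
        have := chartCovector_prod_apply α hx hy (b i) 0
        rw [map_zero] at this
        exact this
      refine ⟨fun hne => ?_, fun hD u v w t => ?_⟩
      · have hex : ∃ i, c Pi (x, y) i ≠ 0 := by
          by_contra! hcon
          refine hne (ContinuousLinearMap.ext fun a => ?_)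
          obtain ⟨a, rfl⟩ := hinv.surjective a
          obtain ⟨L, hL⟩ : ∃ L : E₁ →L[ℝ] ℝ, L = basePart Pi y x := ⟨_, rfl⟩
          have hz0 : ((L.comp (chartInvDeriv I₁ z₀.1 (extChartAt I₁ z₀.1 x)) : E₁ →L[ℝ] ℝ) :
              E₁ →ₗ[ℝ] ℝ) = 0 := by
            refine b.ext fun i => ?_
            rw [hL]
            exact (hc Pi i).symm.trans (hcon i)
          rw [← hL]
          exact congrArg (fun L : E₁ →ₗ[ℝ] ℝ => L a) hz0
        obtain ⟨i, hi⟩ := hex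
        exact Finset.sum_pos' (fun j _ => mul_self_nonneg _)
          ⟨i, Finset.mem_univ i, mul_self_pos.2 hi⟩
      · have hfx := (hfpos x).ne'
        simp only [Finset.sum_mul, ← Finset.sum_add_distrib]
        refine Finset.sum_eq_zero fun i _ => ?_
        have k := fiber_relation_of_differential_eq_zero hgB hgF hf hfpos h0 hD
          (chartInvDeriv I₁ z₀.1 (extChartAt I₁ z₀.1 x) (b i)) u v w t
        simp only at k
        rw [← hc Pi i, ← hc Phi i] at k
        field_simp
        linear_combination c Pi (x, y) i * k
  obtain ⟨g, hg⟩ := exists_contMDiffMap_forall_mem_convex_of_local (I₁.prod I₂) (n := ⊤) hconv hloc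
  have hgs : ContMDiff (I₁.prod I₂) 𝓘(ℝ, ℝ × ℝ) ∞ g := g.contMDiff
  have hg1 : ContMDiff (I₁.prod I₂) 𝓘(ℝ, ℝ) ∞ fun z => (g z).1 :=
    contDiff_fst.contMDiff.comp hgs
  have hg2 : ContMDiff (I₁.prod I₂) 𝓘(ℝ, ℝ) ∞ fun z => (g z).2 :=
    contDiff_snd.contMDiff.comp hgs
  refine ⟨fun z => (g z).2 / (g z).1,
    hg2.contMDiffOn.div₀ hg1.contMDiffOn fun z hz => ((hg z).1 hz).ne', ?_⟩
  rintro z ⟨hW, hD⟩ u v w t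
  have hpos := ((hg z).1 hW).ne'
  have k := (hg z).2 hD u v w t
  simp only
  field_simp
  linear_combination k

end Roter

end WarpedRecurrent

/-! ### Assembly of the theorem. -/

open WarpedRecurrent in
theorem corollary4p11
    {E₁ : Type*} [NormedAddCommGroup E₁] [NormedSpace ℝ E₁] [FiniteDimensional ℝ E₁]
    {H₁ : Type*} [TopologicalSpace H₁] (I₁ : ModelWithCorners ℝ E₁ H₁) [I₁.Boundaryless]
    {B : Type*} [TopologicalSpace B] [T2Space B] [SecondCountableTopology B]
    [ChartedSpace H₁ B] [IsManifold I₁ ∞ B]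
    {E₂ : Type*} [NormedAddCommGroup E₂] [NormedSpace ℝ E₂] [FiniteDimensional ℝ E₂]
    {H₂ : Type*} [TopologicalSpace H₂] (I₂ : ModelWithCorners ℝ E₂ H₂) [I₂.Boundaryless]
    {F : Type*} [TopologicalSpace F] [T2Space F] [SecondCountableTopology F]
    [ChartedSpace H₂ F] [IsManifold I₂ ∞ F] [Nonempty F]
    (gB : BilinField I₁ B) (hgB : IsSemiRiemannian gB)
    (gF : BilinField I₂ F) (hgF : IsSemiRiemannian gF)
    (f : B → ℝ) (hf : ContMDiff I₁ 𝓘(ℝ, ℝ) ∞ f) (hfpos : ∀ x, 0 < f x)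
    (Pi Phi : CovectorField (I₁.prod I₂) (B × F))
    (hM : IsWGK (warpedMetric gB f gF) Pi Phi) :
    -- (i)
    (∀ l : B → ℝ, ContMDiff I₁ 𝓘(ℝ, ℝ) ∞ l → (∀ x, warpT gB f x = l x • ricci gB x) →
      ∃ Pi' Phi' : CovectorField I₁ B, IsWGK gB Pi' Phi' ∧
        {x | ∀ y, (x, y) ∈ wgkSet (warpedMetric gB f gF) Pi Phi} ⊆ wgkSet gB Pi' Phi') ∧
    -- (ii)
    (∀ x : B,
      let q := Module.finrank ℝ E₂
      let P := warpP gB f x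
      let Q := warpQ q gB f x
      let tPi := fiberPart Pi x
      let tPhi := (1 / f x) • fiberPart Phi x
      let tPsi := (2 * Q / f x) • fiberPart Phi x
      let tTheta := (1 / 2 * f x * P) • fiberPart Pi x + (Q ^ 2 / f x) • fiberPart Phi x
      IsSGK gF tPi tPhi tPsi tTheta ∧
        {y | (x, y) ∈ wgkSet (warpedMetric gB f gF) Pi Phi} ⊆ sgkSet gF tPi tPhi tPsi tTheta) ∧
    -- (iii)
    (∃ N₁ N₂ N₃ : B × F → ℝ,
      let W := {z : B × F | differential (I₁ := I₁) f z.1 + f z.1 • basePart Pi z.2 z.1 ≠ 0}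
      ContMDiffOn (I₁.prod I₂) 𝓘(ℝ, ℝ) ∞ N₁ W ∧ ContMDiffOn (I₁.prod I₂) 𝓘(ℝ, ℝ) ∞ N₂ W ∧
      ContMDiffOn (I₁.prod I₂) 𝓘(ℝ, ℝ) ∞ N₃ W ∧
      ∀ z ∈ W ∩ wgkSet (warpedMetric gB f gF) Pi Phi, ∀ u v w t,
        curvature gF z.2 u v w t =
          N₁ z * knAt (gF z.2) (gF z.2) u v w t - N₂ z * knAt (gF z.2) (ricci gF z.2) u v w t
            - N₃ z * knAt (ricci gF z.2) (ricci gF z.2) u v w t) ∧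
    -- (iv)
    (∀ z ∈ wgkSet (warpedMetric gB f gF) Pi Phi,
      (scal gB z.1 - (Module.finrank ℝ E₂ : ℝ) * trace gB z.1 (warpT gB f z.1)) • Phi z ≠ 0 →
        ricci gF z.2 = (scal gF z.2 / (Module.finrank ℝ E₂ : ℝ)) • gF z.2) ∧
    (∀ x : B, differential (I₁ := I₁) f x ≠ 0 →
      ∃ c : ℝ, ∀ (y : F) (u v w t : TangentSpace I₂ y),
        curvature gF y u v w t = c * knAt (gF y) (gF y) u v w t) := by 
  refine ⟨fun l hl hT => exists_base_wgk hgB hgF hf hfpos hM hl hT,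
    fun x => fiber_sgk hgB hgF hf hfpos hM x rfl rfl, ?_,
    fun z hz => fiber_einstein hgB hgF hf hfpos hz,
    fun x hx => exists_constant_curvature hgB hgF hf hfpos hM hx⟩
  -- If $df$ vanishes identically, $W$ lies in $\{\overline\Pi\neq0\}$ and only $N_3$ is needed. A
  -- single point with $df\neq0$ makes the whole fiber of constant curvature, and the constant
  -- $N_1=c$ suffices.
  by_cases h0 : ∀ x, differential (I₁ := I₁) f x = 0
  · obtain ⟨N, hN, hR⟩ := exists_roter hgB hgF hf hfpos hM h0
    have hsub : {z : B × F | differential (I₁ := I₁) f z.1 + f z.1 • basePart Pi z.2 z.1 ≠ 0} ⊆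
        {z | basePart Pi z.2 z.1 ≠ 0} := by
      intro z hz h
      refine hz ?_
      rw [h0, h, smul_zero, add_zero]
    refine ⟨0, 0, N, contMDiffOn_const, contMDiffOn_const, hN.mono hsub,
      fun z hz u v w t => ?_⟩
    rw [hR z ⟨hsub hz.1, hz.2⟩]
    simp
  · push Not at h0
    obtain ⟨x, hx⟩ := h0
    obtain ⟨c, hc⟩ := exists_constant_curvature hgB hgF hf hfpos hM hx
    refine ⟨fun _ => c, 0, 0, contMDiffOn_const, contMDiffOn_const, contMDiffOn_const,
      fun z _ u v w t => ?_⟩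
    rw [hc]
    simp
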